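/- Let $G$ be a (second countable, finite-dimensional real) Lie group with Lie algebra $\mathfrak g$, $\Gamma<G$ a lattice, $X=G/\Gamma$, and $\mu$ the $G$-invariant Borel probability measure on $X$. Let $\mathbf d$ be the distance on $X$ induced by a right-invariant Riemannian metric on $G$ (the infimum of the distances of representatives). Let $(a_t)_{t\in\mathbb R}$ be a one-parameter subgroup of $G$ such that $\mathrm{Ad}(a_t)$ is diagonalizable: there are a basis $\zeta_1,\dots,\zeta_d$ of $\mathfrak g$ and $\gamma_1,\dots,\gamma_d\in\mathbb R$ with $\mathrm{Ad}(a_t)\zeta_i=e^{\gamma_i t}\zeta_i$ for all $t\in\mathbb{R}$ and all $i$. Put $\gamma=\max_i\gamma_i$. For $\zeta\in\mathfrak g$ and $f:X\to\mathbb R$ put $D_\zeta f(x)=\frac{d}{dt}f(\exp(t\zeta)x)\big|_{t=0}$. Let $k\ge 1$ be an integer, and let $W^{(2,k)}(X)$ be the set of functions $f$ for which all iterated derivatives $D_{\zeta_{n_1}}\cdots D_{\zeta_{n_l}}f$ with $0\le l\le k$ exist everywhere and lie in $L^2(\mu)$, with the norm $$S_k(f)^2=\|f\|_2^2+\sum_{l=1}^k\sum_{n_1,\dots,n_l=1}^d\|D_{\zeta_{n_1}}\cdots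 D_{\zeta_{n_l}}f\|_2^2 .$$ Let $\delta>0$ and assume that $a_t$ has exponential decay of correlations with rate $\delta$ against $W^{(2,k)}$ observables: there is $c>0$ such that for all $f,g\in W^{(2,k)}(X)$ and all $t\ge 0$, $$\Big|\int_X f(x)\,g(a_tx)\,d\mu(x)-\int_X f\,d\mu\int_X g\,d\mu\Big|\le c\,e^{-\delta t}S_k(f)S_k(g).$$ Let $(m_j)$ be a sequence of real numbers that is positive for all large $j$, and assume that $\gamma>0$ and $$\limsup_{j\to\infty}\frac{m_{j-1}}{m_j}<\min\Big(1,\frac{\delta}{k\gamma}\Big).$$ Let $\alpha_n<\beta_n$ be natural numbers with $\alpha_n\to\infty$ and $\beta_n-\alpha_n\to\infty$, and put $N_n=\beta_n-\alpha_n+1$. For $\mathcal D:X\to\mathbb R$ put $M_{I_n}(x)=\max_{\alpha_n\le i\le\beta_n}\mathcal D(a_{m_i}x)$ and $\Phi_{\mathcal D}(z)=\mu(\{x:\mathcal D(x)\ge z\})$. Let $r\in\mathbb R$. (A) Let $w,v>0$, and let $\mathcal D$ be $(w,v)$-strong-distance-like, i.e. uniformly continuous with respect to $\mathbf d$ with $\Phi_{\mathcal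 D}(z)=we^{-vz}+o(e^{-vz})$ as $z\to\infty$. Then, with $u_n(r)=r+\frac1v\log N_n$, $$\lim_{n\to\infty}\mu(M_{I_n}\le u_n(r))=e^{-we^{-vr}}.$$ (B) Let $w_1,w_2,v>0$, and let $\mathcal D$ be $(w_1,w_2,v)$-distance-like, i.e. uniformly continuous with respect to $\mathbf d$ with $w_1e^{-vz}\le\Phi_{\mathcal D}(z)\le w_2e^{-vz}$ for all sufficiently large $z$. Then, with $u_n(r)=r+\frac1v\log N_n$, $$e^{-w_2e^{-vr}}\le\liminf_{n\to\infty}\mu(M_{I_n}\le u_n(r))\le\limsup_{n\to\infty}\mu(M_{I_n}\le u_n(r))\le e^{-w_1e^{-vr}}.$$ -/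

import Mathlib

open Filter Topology MeasureTheory Asymptotics
open scoped Manifold ContDiff ENNReal

noncomputable section

namespace Homogeneous

section LieTheory

variable (E : Type*) [NormedAddCommGroup E] [NormedSpace ℝ E]
  {G : Type*} [TopologicalSpace G] [ChartedSpace E G] [Group G]

/-- A one-parameter subgroup `t ↦ c t`: a continuous homomorphism from `(ℝ, +)` to `G`. -/
structure IsOneParameterSubgroup {G : Type*} [TopologicalSpace G] [Group G] (c : ℝ → G) : Prop where
  continuous : Continuous c
  map_add : ∀ s t : ℝ, c (s + t) = c s * c t

/-- The one-parameter subgroup `c` has initial velocity `ζ`. -/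
def HasInitialVelocity (c : ℝ → G) (ζ : GroupLieAlgebra 𝓘(ℝ, E) G) : Prop :=
  MDifferentiableAt 𝓘(ℝ, ℝ) 𝓘(ℝ, E) c 0 ∧
    (mfderiv 𝓘(ℝ, ℝ) 𝓘(ℝ, E) c 0 (1 : ℝ) : E) = (ζ : E)

open Classical in
/-- The Lie exponential: `exp ζ = c 1`, where `c` is the one-parameter subgroup with
initial velocity `ζ`. -/
def lieExp (ζ : GroupLieAlgebra 𝓘(ℝ, E) G) : G :=
  if h : ∃ c : ℝ → G, IsOneParameterSubgroup c ∧ HasInitialVelocity E c ζ then h.choose 1 else 1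

/-- The adjoint action `Ad g`: the differential at the identity of `h ↦ g * h * g⁻¹`. -/
def Ad (g : G) : GroupLieAlgebra 𝓘(ℝ, E) G → GroupLieAlgebra 𝓘(ℝ, E) G :=
  fun ζ => (mfderiv 𝓘(ℝ, E) 𝓘(ℝ, E) (fun h : G => g * h * g⁻¹) 1 ζ : E)

end LieTheory

section Metric

variable {E : Type*} [NormedAddCommGroup E] [NormedSpace ℝ E]
  {G : Type*} [TopologicalSpace G] [ChartedSpace E G] [Group G] [LieGroup 𝓘(ℝ, E) ∞ G]

/-- Smooth Riemannian metrics on the Lie group `G`. -/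
abbrev RiemannianMetricOn (E : Type*) [NormedAddCommGroup E] [NormedSpace ℝ E]
    (G : Type*) [TopologicalSpace G] [ChartedSpace E G] [Group G] [LieGroup 𝓘(ℝ, E) ∞ G] :=
  Bundle.ContMDiffRiemannianMetric 𝓘(ℝ, E) ∞ E (fun g : G => TangentSpace 𝓘(ℝ, E) g)

/-- Right invariance: every right translation `x ↦ x * h` is a linear isometry on tangent spaces. -/
def IsRightInvariant (ρ : RiemannianMetricOn E G) : Prop :=
  ∀ (g h : G) (v w : TangentSpace 𝓘(ℝ, E) g),
    ρ.inner (g * h) (mfderiv 𝓘(ℝ, E) 𝓘(ℝ, E) (fun x : G => x * h) g v)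
      (mfderiv 𝓘(ℝ, E) 𝓘(ℝ, E) (fun x : G => x * h) g w) = ρ.inner g v w

open scoped Bundle in
/-- The Riemannian distance on `G` (infimum of the lengths of `C¹` paths;
it is `∞` between different components of `G`). -/
def groupEDist (ρ : RiemannianMetricOn E G) (g h : G) : ℝ≥0∞ :=
  letI : Bundle.RiemannianBundle (fun g : G => TangentSpace 𝓘(ℝ, E) g) := ⟨ρ.toRiemannianMetric⟩
  Manifold.riemannianEDist 𝓘(ℝ, E) g h

/-- The induced distance on `X = G ⧸ Γ`: the infimum of the distances of representatives. -/
def quotientEDist (ρ : RiemannianMetricOn E G) (Γ : Subgroup G) (x y : G ⧸ Γ) : ℝ≥0∞ :=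
  ⨅ (g : G) (h : G) (_ : (g : G ⧸ Γ) = x) (_ : (h : G ⧸ Γ) = y), groupEDist ρ g h

/-- Uniform continuity of `D : X → ℝ` for the induced distance on `X = G ⧸ Γ`. -/
def IsUniformlyContinuous (ρ : RiemannianMetricOn E G) {Γ : Subgroup G} (D : G ⧸ Γ → ℝ) : Prop :=
  ∀ ε : ℝ, 0 < ε → ∃ η : ℝ, 0 < η ∧ ∀ x y : G ⧸ Γ,
    quotientEDist ρ Γ x y < ENNReal.ofReal η → |D x - D y| < ε

/-- The tail distribution function `z ↦ μ {x | D x ≥ z}`. -/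
def tail {X : Type*} [MeasurableSpace X] (μ : Measure X) (D : X → ℝ) (z : ℝ) : ℝ :=
  μ.real {x | z ≤ D x}

/-- `(w, v)`-SDL ("strong-distance-like") observables. -/
structure IsSDL (ρ : RiemannianMetricOn E G) {Γ : Subgroup G} [MeasurableSpace (G ⧸ Γ)]
    (μ : Measure (G ⧸ Γ)) (D : G ⧸ Γ → ℝ) (w v : ℝ) : Prop where
  uniformlyContinuous : IsUniformlyContinuous ρ D
  tail_isLittleO : (fun z : ℝ => tail μ D z - w * Real.exp (-v * z)) =o[atTop]
    fun z : ℝ => Real.exp (-v * z)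

/-- `(w₁, w₂, v)`-DL ("distance-like") observables. The two-sided bound is required for all
sufficiently large `z` (for `z → -∞` the lower bound fails for every observable). -/
structure IsDL (ρ : RiemannianMetricOn E G) {Γ : Subgroup G} [MeasurableSpace (G ⧸ Γ)]
    (μ : Measure (G ⧸ Γ)) (D : G ⧸ Γ → ℝ) (w₁ w₂ v : ℝ) : Prop where
  uniformlyContinuous : IsUniformlyContinuous ρ D
  tail_bounds : ∀ᶠ z : ℝ in atTop,
    w₁ * Real.exp (-v * z) ≤ tail μ D z ∧ tail μ D z ≤ w₂ * Real.exp (-v * z)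

end Metric

section Sobolev

variable {E : Type*} [NormedAddCommGroup E] [NormedSpace ℝ E]
  {G : Type*} [TopologicalSpace G] [ChartedSpace E G] [Group G] {Γ : Subgroup G}

/-- `D_ζ f (x) = d/dt f (exp (t ζ) x)` at `t = 0`. -/
def lieDeriv (ζ : GroupLieAlgebra 𝓘(ℝ, E) G) (f : G ⧸ Γ → ℝ) (x : G ⧸ Γ) : ℝ :=
  deriv (fun t : ℝ => f (lieExp E (t • ζ) • x)) 0

/-- The derivative `D_ζ f` exists at every point of `X`. -/
def LieDifferentiable (ζ : GroupLieAlgebra 𝓘(ℝ, E) G) (f : G ⧸ Γ → ℝ) : Prop :=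
  ∀ x : G ⧸ Γ, DifferentiableAt ℝ (fun t : ℝ => f (lieExp E (t • ζ) • x)) 0

/-- The iterated derivative `D_{ζ (n₁)} ⋯ D_{ζ (n_l)} f` for the word `[n₁, …, n_l]`. -/
def iterLieDeriv {ι : Type*} (ζ : ι → GroupLieAlgebra 𝓘(ℝ, E) G) :
    List ι → (G ⧸ Γ → ℝ) → G ⧸ Γ → ℝ
  | [], f => f
  | i :: L, f => lieDeriv (ζ i) (iterLieDeriv ζ L f)

variable [MeasurableSpace (G ⧸ Γ)] (μ : Measure (G ⧸ Γ))

/-- The space `W^{(2,k)}(X)`: all iterated derivatives up to order `k` in the directions `ζ i`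
exist and lie in `L²`. -/
structure MemSobolev {ι : Type*} (ζ : ι → GroupLieAlgebra 𝓘(ℝ, E) G) (k : ℕ)
    (f : G ⧸ Γ → ℝ) : Prop where
  differentiable : ∀ L : List ι, L.length < k → ∀ i : ι, LieDifferentiable (ζ i) (iterLieDeriv ζ L f)
  memLp : ∀ L : List ι, L.length ≤ k → MemLp (iterLieDeriv ζ L f) 2 μ

/-- The `k`-th Sobolev norm
`S_k(f)² = ∑_{l ≤ k} ∑_{n₁, …, n_l} ‖D_{ζ (n₁)} ⋯ D_{ζ (n_l)} f‖₂²`. -/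
def sobolevNorm {ι : Type*} [Fintype ι] (ζ : ι → GroupLieAlgebra 𝓘(ℝ, E) G) (k : ℕ)
    (f : G ⧸ Γ → ℝ) : ℝ :=
  Real.sqrt (∑ l ∈ Finset.range (k + 1), ∑ n : Fin l → ι,
    (eLpNorm (iterLieDeriv ζ (List.ofFn n) f) 2 μ).toReal ^ 2)

/-- Exponential decay of correlations of `a_t` against `W^{(2,k)}` observables, with rate `δ`. -/
def HasExpDecay {ι : Type*} [Fintype ι] (ζ : ι → GroupLieAlgebra 𝓘(ℝ, E) G) (a : ℝ → G)
    (k : ℕ) (δ : ℝ) : Prop :=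
  ∃ c : ℝ, 0 < c ∧ ∀ f g : G ⧸ Γ → ℝ, MemSobolev μ ζ k f → MemSobolev μ ζ k g →
    ∀ t : ℝ, 0 ≤ t →
      |∫ x, f x * g (a t • x) ∂μ - (∫ x, f x ∂μ) * ∫ x, g x ∂μ| ≤
        c * Real.exp (-δ * t) * sobolevNorm μ ζ k f * sobolevNorm μ ζ k g

end Sobolev

/-- `M_I (x) = max_{p ≤ i ≤ q} D (a_{m_i} x)` for the window of indices `p ≤ i ≤ q`. -/
def windowMax {G : Type*} [Group G] {Γ : Subgroup G} (a : ℝ → G) (m : ℕ → ℝ) (D : G ⧸ Γ → ℝ)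
    {p q : ℕ} (hpq : p < q) (x : G ⧸ Γ) : ℝ :=
  (Finset.Icc p q).sup' (Finset.nonempty_Icc.2 hpq.le) fun i => D (a (m i) • x)

/-- The level `u(r) = r + (1/v) log N`, where `N = q - p + 1` is the number of indices
in the window `p ≤ i ≤ q`. -/
def level (v : ℝ) (p q : ℕ) (r : ℝ) : ℝ :=
  r + 1 / v * Real.log ((q : ℝ) - (p : ℝ) + 1)

end Homogeneous

end

/-!
Write `P` for the probability that `D (a_{m_i} x) ≤ u` for all `i` in a window of `N` indices, at a
level `u` for which `{D ≥ u}` has measure of order `1 / N`. The theorem says that `P` behaves as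
if the `N` events were independent, that is, like `(1 - tail μ D u) ^ N`.

*Cut-offs.* Averaging the indicator function of `{D ≤ z}` over small translates `g • x`, with a
smooth compactly supported weight `θ` on `G` and a right-invariant measure, gives `φ` with
`1_{D ≤ z - ε} ≤ φ ≤ 1_{D ≤ z + ε}`, because `D` is uniformly continuous and the distance from `x`
to `g • x` is at most that from `1` to `g`. A derivative `D_ζ φ` is again such an average, with `θ`
replaced by a derivative of `θ` along a left-invariant vector field, so all derivatives of `φ` of
order at most `k` are bounded independently of the level `z`
(`exists_hasDerivBounds_weightedAverage`, `exists_smooth_cutOff`).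

*Decorrelation.* Conjugation by `a_t` multiplies the direction `ζ i` by `exp (γ i * t)`, and by the
Leibniz rule the derivatives of order `l` of `F x = ∏_{i ≤ j} φ (a_{m_i} x)` are bounded by
`(N * R * exp (γ * m_j)) ^ l`, where `γ` is the largest of the `γ i`. Exponential decay of
correlations applied to `F` and `φ` at time `m_{j+1}` then has an error of order
`N ^ k * exp (-(δ * m_{j+1} - k * γ * m_j))`, and the sparsity hypothesis bounds this by
`N ^ k * exp (-κ * m_{j+1})` for some `κ > 0`. Splitting off one factor at a time gives
`∫ ∏ φ (a_{m_i} x) ≈ (∫ φ) ^ N` (`exists_decorrelation_bound`).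

*Conclusion.* The window may start so early that `exp (-κ * m_i)` does not beat a power of `N`.
Discarding the first `√N` indices changes `P` by at most `√N * tail μ D u`, which tends to zero;
for the remaining ones `m_i` is at least a multiple of `√N` and the error tends to zero
(`exists_window_bounds`). Letting `N → ∞` and then `ε → 0` gives the two one-sided estimates
`HasWindowBounds.eventually_lt` and `HasWindowBounds.eventually_gt`. Each uses only one side of the
tail bounds; the second statement of the theorem is their conjunction, and the first one follows
by applying them with `w - η` and `w + η` for arbitrarily small `η > 0`.
-/

namespace Homogeneous

/-! ### One-parameter subgroups and the exponential map -/

section OneParameterSubgroups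

variable {E : Type*} [NormedAddCommGroup E] [NormedSpace ℝ E]
  {G : Type*} [TopologicalSpace G] [ChartedSpace E G] [Group G]

/-- The initial velocity as a manifold derivative, with all tangent spaces of `G` identified
with `E`. -/
theorem hasInitialVelocity_iff {c : ℝ → G} {ζ : GroupLieAlgebra 𝓘(ℝ, E) G} :
    HasInitialVelocity E c ζ ↔ HasMFDerivAt 𝓘(ℝ, ℝ) 𝓘(ℝ, E) c 0
      ((1 : ℝ →L[ℝ] ℝ).smulRight (ζ : E) : ℝ →L[ℝ] E) := by
  constructor
  · intro h
    refine h.1.hasMFDerivAt.congr_mfderiv ?_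
    have h2 : (mfderiv 𝓘(ℝ, ℝ) 𝓘(ℝ, E) c 0 : ℝ →L[ℝ] E) 1 = (ζ : E) := h.2
    generalize (mfderiv 𝓘(ℝ, ℝ) 𝓘(ℝ, E) c 0 : ℝ →L[ℝ] E) = L at h2
    change (L : ℝ →L[ℝ] E) = (1 : ℝ →L[ℝ] ℝ).smulRight (ζ : E)
    ext
    exact h2.trans (one_smul ℝ (ζ : E)).symm
  · intro h
    refine ⟨h.mdifferentiableAt, ?_⟩
    rw [h.mfderiv]
    exact one_smul ℝ (ζ : E)

variable [LieGroup 𝓘(ℝ, E) ∞ G]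

/-- Left-invariant vector fields are `C^∞`: they are the composition of the derivative of the
multiplication with `g ↦ ((g, 0), (1, ζ))`. -/
theorem contMDiff_mulInvariantVectorField_infty (ζ : GroupLieAlgebra 𝓘(ℝ, E) G) :
    ContMDiff 𝓘(ℝ, E) 𝓘(ℝ, E).tangent ∞
      (fun g : G => (⟨g, mulInvariantVectorField ζ g⟩ : TangentBundle 𝓘(ℝ, E) G)) := by
  let I := 𝓘(ℝ, E)
  let fg : G → TangentBundle I G := fun g ↦ Bundle.TotalSpace.mk' E g 0
  have sfg : ContMDiff I I.tangent ∞ fg := Bundle.contMDiff_zeroSection _ _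
  let fv : G → TangentBundle I G := fun _ ↦ Bundle.TotalSpace.mk' E 1 ζ
  have sfv : ContMDiff I I.tangent ∞ fv := contMDiff_const
  let F₁ : G → (TangentBundle I G × TangentBundle I G) := fun g ↦ (fg g, fv g)
  have S₁ : ContMDiff I (I.tangent.prod I.tangent) ∞ F₁ := sfg.prodMk sfv
  let F₂ : (TangentBundle I G × TangentBundle I G) → TangentBundle (I.prod I) (G × G) :=
    (equivTangentBundleProd I G I G).symm
  have S₂ : ContMDiff (I.tangent.prod I.tangent) (I.prod I).tangent ∞ F₂ :=
    contMDiff_equivTangentBundleProd_symm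
  let F₃ : TangentBundle (I.prod I) (G × G) → TangentBundle I G :=
    tangentMap (I.prod I) I (fun (p : G × G) ↦ p.1 * p.2)
  have S₃ : ContMDiff (I.prod I).tangent I.tangent ∞ F₃ :=
    ContMDiff.contMDiff_tangentMap (contMDiff_mul I ∞) (m := ∞) (by simp)
  have e : (fun g : G => (⟨g, mulInvariantVectorField ζ g⟩ : TangentBundle I G)) =
      F₃ ∘ F₂ ∘ F₁ := by
    funext g
    have h := mfderiv_prod_eq_add_apply (I := I) (I' := I) (I'' := I) (p := (g, (1 : G)))
      (v := ((0 : E), (ζ : E)))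
      ((contMDiff_mul I (∞ : WithTop ℕ∞) (G := G)).mdifferentiableAt (by simp))
    have h2 : (mfderiv (I.prod I) I (fun p : G × G => p.1 * p.2) (g, 1) ((0 : E), (ζ : E)) : E) =
        mulInvariantVectorField (I := I) ζ g := by
      have h0 : (mfderiv I I (fun z : G => z * 1) g (0 : E) : E) = 0 :=
        map_zero (mfderiv I I (fun z : G => z * 1) g)
      have hadd : ∀ u v : E, u = 0 → u + v = v := fun u v hu => by rw [hu, zero_add]
      exact h.trans (hadd _ _ h0)
    -- the base points `g` and `g * 1` are equal only propositionally
    have hcast : ∀ (x y : G) (v w : E), x = y → v = w →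
        (⟨x, v⟩ : TangentBundle I G) = ⟨y, w⟩ := by
      rintro x _ v _ rfl rfl
      rfl
    exact hcast _ _ _ _ (mul_one g).symm h2.symm
  rw [e]
  exact S₃.comp (S₂.comp S₁)

theorem comp_smulRight_one {F F' : Type*} [NormedAddCommGroup F] [NormedSpace ℝ F]
    [NormedAddCommGroup F'] [NormedSpace ℝ F'] (L : F →L[ℝ] F') (v : F) :
    L.comp ((1 : ℝ →L[ℝ] ℝ).smulRight v) = (1 : ℝ →L[ℝ] ℝ).smulRight (L v) := by
  ext
  simp

theorem IsOneParameterSubgroup.map_zero {G : Type*} [TopologicalSpace G] [Group G] {c : ℝ → G}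
    (hc : IsOneParameterSubgroup c) : c 0 = 1 := by
  have h := hc.map_add 0 0
  rw [add_zero] at h
  exact (mul_eq_left.1 h.symm)

theorem IsOneParameterSubgroup.map_neg {G : Type*} [TopologicalSpace G] [Group G] {c : ℝ → G}
    (hc : IsOneParameterSubgroup c) (t : ℝ) : c (-t) = (c t)⁻¹ := by
  rw [eq_inv_iff_mul_eq_one, ← hc.map_add, neg_add_cancel, hc.map_zero]

theorem IsOneParameterSubgroup.isMIntegralCurve {c : ℝ → G} (hc : IsOneParameterSubgroup c)
    {ζ : GroupLieAlgebra 𝓘(ℝ, E) G} (hv : HasInitialVelocity E c ζ) :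
    IsMIntegralCurve c (mulInvariantVectorField (I := 𝓘(ℝ, E)) ζ) := by
  intro t
  have h0 : c 0 = 1 := hc.map_zero
  have e : c = (fun g => c t * g) ∘ c ∘ fun s : ℝ => s - t := by
    funext s
    simp [← hc.map_add]
  have h1 : HasMFDerivAt 𝓘(ℝ, ℝ) 𝓘(ℝ, ℝ) (fun s : ℝ => s - t) t (ContinuousLinearMap.id ℝ ℝ) :=
    ((hasFDerivAt_id t).sub_const t).hasMFDerivAt
  have h2 : HasMFDerivAt 𝓘(ℝ, ℝ) 𝓘(ℝ, E) c (t - t)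
      ((1 : ℝ →L[ℝ] ℝ).smulRight (ζ : E) : ℝ →L[ℝ] E) := by
    rw [sub_self]
    exact hasInitialVelocity_iff.1 hv
  have h3 : HasMFDerivAt 𝓘(ℝ, E) 𝓘(ℝ, E) (fun g : G => c t * g) (c (t - t))
      (mfderiv 𝓘(ℝ, E) 𝓘(ℝ, E) (fun g : G => c t * g) 1) := by
    rw [sub_self, h0]
    exact (contMDiff_mul_left (I := 𝓘(ℝ, E)) (n := ∞)).mdifferentiableAt (by simp) |>.hasMFDerivAt
  have h := h3.comp t (h2.comp (f := fun s : ℝ => s - t) t h1)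
  exact (h.congr_of_eventuallyEq (Filter.EventuallyEq.of_eq e)).congr_mfderiv
    (comp_smulRight_one (F := E) (F' := E) _ _)

/-- Left translation maps integral curves of a left-invariant vector field to integral curves. -/
theorem isMIntegralCurve_mul_left {ζ : GroupLieAlgebra 𝓘(ℝ, E) G} {c : ℝ → G} {s : Set ℝ}
    (hc : IsMIntegralCurveOn c (mulInvariantVectorField (I := 𝓘(ℝ, E)) ζ) s) (g : G) :
    IsMIntegralCurveOn (fun t => g * c t) (mulInvariantVectorField (I := 𝓘(ℝ, E)) ζ) s := by
  intro t ht
  have md : ∀ g h : G, MDifferentiableAt 𝓘(ℝ, E) 𝓘(ℝ, E) (fun x : G => g * x) h := fun g h =>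
    (contMDiff_mul_left (I := 𝓘(ℝ, E)) (n := ∞)).mdifferentiableAt (by simp)
  have h := (md g (c t)).hasMFDerivAt.comp_hasMFDerivWithinAt t (hc t ht)
  have e : mulInvariantVectorField (I := 𝓘(ℝ, E)) ζ (g * c t) =
      mfderiv 𝓘(ℝ, E) 𝓘(ℝ, E) (fun x : G => g * x) (c t)
        (mulInvariantVectorField (I := 𝓘(ℝ, E)) ζ (c t)) := by
    have e1 : (fun x : G => g * c t * x) = (fun x => g * x) ∘ fun x => c t * x := by
      funext x; simp [mul_assoc]
    have e2 := mfderiv_comp (I := 𝓘(ℝ, E)) (I' := 𝓘(ℝ, E)) (I'' := 𝓘(ℝ, E)) (1 : G)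
      (g := fun x => g * x) (f := fun x => c t * x) (md _ _) (md _ _)
    simp only [mulInvariantVectorField]
    rw [e1, e2]
    change mfderiv 𝓘(ℝ, E) 𝓘(ℝ, E) (fun x : G => g * x) (c t * 1) _ = _
    rw [mul_one]
    rfl
  refine HasMFDerivWithinAt.congr_mfderiv h ?_
  rw [e]
  exact comp_smulRight_one (F := E) (F' := E) _ _

variable [T2Space G]

theorem IsOneParameterSubgroup.eq_of_hasInitialVelocity {c c' : ℝ → G}
    (hc : IsOneParameterSubgroup c) (hc' : IsOneParameterSubgroup c')
    {ζ : GroupLieAlgebra 𝓘(ℝ, E) G} (hv : HasInitialVelocity E c ζ)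
    (hv' : HasInitialVelocity E c' ζ) : c = c' := by
  have hM : IsManifold 𝓘(ℝ, E) 1 G := IsManifold.of_le (n := ∞) (by simp)
  exact isMIntegralCurve_Ioo_eq_of_contMDiff_boundaryless (t₀ := 0)
    ((contMDiff_mulInvariantVectorField_infty ζ).of_le (by simp))
    (hc.isMIntegralCurve hv) (hc'.isMIntegralCurve hv') (by rw [hc.map_zero, hc'.map_zero])

theorem IsOneParameterSubgroup.lieExp_eq {c : ℝ → G} (hc : IsOneParameterSubgroup c)
    {ζ : GroupLieAlgebra 𝓘(ℝ, E) G} (hv : HasInitialVelocity E c ζ) : lieExp E ζ = c 1 := by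
  have h : ∃ c : ℝ → G, IsOneParameterSubgroup c ∧ HasInitialVelocity E c ζ := ⟨c, hc, hv⟩
  rw [lieExp, dif_pos h]
  exact congrFun (h.choose_spec.1.eq_of_hasInitialVelocity hc h.choose_spec.2 hv) 1

theorem IsOneParameterSubgroup.lieExp_smul_eq {c : ℝ → G} (hc : IsOneParameterSubgroup c)
    {ζ : GroupLieAlgebra 𝓘(ℝ, E) G} (hv : HasInitialVelocity E c ζ) (t : ℝ) :
    lieExp E (t • ζ) = c t := by
  have h1 : HasMFDerivAt 𝓘(ℝ, ℝ) 𝓘(ℝ, ℝ) (fun s : ℝ => t * s) 0 (t • ContinuousLinearMap.id ℝ ℝ) :=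
    ((hasFDerivAt_id (0 : ℝ)).const_mul t).hasMFDerivAt
  have h2 : HasMFDerivAt 𝓘(ℝ, ℝ) 𝓘(ℝ, E) c (t * 0)
      ((1 : ℝ →L[ℝ] ℝ).smulRight (ζ : E) : ℝ →L[ℝ] E) := by
    rw [mul_zero]; exact hasInitialVelocity_iff.1 hv
  have h := h2.comp (0 : ℝ) h1
  have hc' : IsOneParameterSubgroup (c ∘ fun s => t * s) :=
    ⟨hc.continuous.comp (by fun_prop), fun a b => by simp [mul_add, hc.map_add]⟩
  rw [hc'.lieExp_eq (ζ := t • ζ) (hasInitialVelocity_iff.2 (h.congr_mfderiv ?_))]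
  · simp
  · change ((1 : ℝ →L[ℝ] ℝ).smulRight (ζ : E)).comp (t • ContinuousLinearMap.id ℝ ℝ) =
      (1 : ℝ →L[ℝ] ℝ).smulRight (t • (ζ : E))
    ext
    simp

variable [FiniteDimensional ℝ E]

/-- By left translation, a local integral curve at the identity gives integral curves on an interval
of the same length at every point, so the integral curves of a left-invariant field are global. -/
theorem exists_isOneParameterSubgroup (ζ : GroupLieAlgebra 𝓘(ℝ, E) G) :
    ∃ c : ℝ → G, IsOneParameterSubgroup c ∧ HasInitialVelocity E c ζ := by
  have : CompleteSpace E := FiniteDimensional.complete ℝ E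
  have hM : IsManifold 𝓘(ℝ, E) 1 G := IsManifold.of_le (n := ∞) (by simp)
  have hV : ContMDiff 𝓘(ℝ, E) 𝓘(ℝ, E).tangent 1
      (fun g : G => (⟨g, mulInvariantVectorField ζ g⟩ : TangentBundle 𝓘(ℝ, E) G)) :=
    (contMDiff_mulInvariantVectorField_infty ζ).of_le (by simp)
  obtain ⟨c₀, hc₀, h⟩ := exists_isMIntegralCurveAt_of_contMDiffAt_boundaryless 0
    (hV.contMDiffAt (x := (1 : G)))
  obtain ⟨ε, hε, h⟩ := isMIntegralCurveAt_iff'.1 h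
  rw [Real.ball_eq_Ioo, zero_sub, zero_add] at h
  obtain ⟨c, hc, hcI⟩ := exists_isMIntegralCurve_of_isMIntegralCurveOn hV hε
    (fun g => ⟨fun t => g * c₀ t, by simp [hc₀], isMIntegralCurve_mul_left h g⟩) (1 : G)
  refine ⟨c, ⟨hcI.continuous, fun s t => ?_⟩, ?_⟩
  · have e := isMIntegralCurve_Ioo_eq_of_contMDiff_boundaryless (t₀ := 0) hV
      (hcI.comp_add s) (isMIntegralCurve_iff_isMIntegralCurveOn.2
        (isMIntegralCurve_mul_left (hcI.isMIntegralCurveOn Set.univ) (c s))) (by simp [hc])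
    have := congrFun e t
    simpa [add_comm] using this
  · have h0 := hcI 0
    refine hasInitialVelocity_iff.2 (h0.congr_mfderiv ?_)
    have e : (mulInvariantVectorField (I := 𝓘(ℝ, E)) ζ (c 0) : E) = (ζ : E) := by
      rw [hc]
      have e1 : (fun x : G => 1 * x) = id := funext one_mul
      simp only [mulInvariantVectorField]
      rw [e1, mfderiv_id]
      rfl
    exact congrArg (fun v : E => (1 : ℝ →L[ℝ] ℝ).smulRight v) e

theorem isOneParameterSubgroup_lieExp (ζ : GroupLieAlgebra 𝓘(ℝ, E) G) :
    IsOneParameterSubgroup (fun t : ℝ => lieExp E (t • ζ)) := by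
  obtain ⟨c, hc, hv⟩ := exists_isOneParameterSubgroup ζ
  have : (fun t : ℝ => lieExp E (t • ζ)) = c := funext (hc.lieExp_smul_eq hv)
  rwa [this]

theorem hasInitialVelocity_lieExp (ζ : GroupLieAlgebra 𝓘(ℝ, E) G) :
    HasInitialVelocity E (fun t : ℝ => lieExp E (t • ζ)) ζ := by
  obtain ⟨c, hc, hv⟩ := exists_isOneParameterSubgroup ζ
  have : (fun t : ℝ => lieExp E (t • ζ)) = c := funext (hc.lieExp_smul_eq hv)
  rwa [this]

/-- Conjugation by `g` rescales the time of the one-parameter subgroup of an eigenvector of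
`Ad g`. -/
theorem mul_lieExp_smul {g : G} {ζ : GroupLieAlgebra 𝓘(ℝ, E) G} {lam : ℝ}
    (h : Ad E g ζ = lam • ζ) (t : ℝ) :
    g * lieExp E (t • ζ) = lieExp E ((lam * t) • ζ) * g := by
  have hc := isOneParameterSubgroup_lieExp ζ
  have hv := hasInitialVelocity_lieExp ζ
  have := topologicalGroup_of_lieGroup 𝓘(ℝ, E) (G := G) ∞
  have hconj : Continuous fun h : G => g * h * g⁻¹ := by fun_prop
  have hc' : IsOneParameterSubgroup ((fun h : G => g * h * g⁻¹) ∘ fun t : ℝ => lieExp E (t • ζ)) :=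
    ⟨hconj.comp hc.continuous, fun a b => by simp [hc.map_add a b, mul_assoc]⟩
  have hd : MDifferentiableAt 𝓘(ℝ, E) 𝓘(ℝ, E) (fun h : G => g * h * g⁻¹) 1 :=
    ((contMDiff_mul_right (I := 𝓘(ℝ, E)) (n := ∞) (a := g⁻¹)).comp
      (contMDiff_mul_left (I := 𝓘(ℝ, E)) (n := ∞) (a := g))).mdifferentiableAt (by simp)
  have h0 : (fun t : ℝ => lieExp E (t • ζ)) 0 = 1 := hc.map_zero
  have hd' : HasMFDerivAt 𝓘(ℝ, E) 𝓘(ℝ, E) (fun h : G => g * h * g⁻¹)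
      ((fun t : ℝ => lieExp E (t • ζ)) 0)
      (mfderiv 𝓘(ℝ, E) 𝓘(ℝ, E) (fun h : G => g * h * g⁻¹) 1) := by
    rw [h0]; exact hd.hasMFDerivAt
  have hcomp := hd'.comp (0 : ℝ) (hasInitialVelocity_iff.1 hv)
  have hv' : HasInitialVelocity E
      ((fun h : G => g * h * g⁻¹) ∘ fun t : ℝ => lieExp E (t • ζ)) (lam • ζ) := by
    refine hasInitialVelocity_iff.2 (hcomp.congr_mfderiv ?_)
    rw [← h]
    exact comp_smulRight_one (F := E) (F' := E) _ _
  have e1 := hc'.lieExp_smul_eq hv' t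
  rw [smul_smul, mul_comm] at e1
  rw [e1]
  simp

end OneParameterSubgroups

/-! ### Functions with geometrically bounded iterated derivatives -/

section BoundedDerivatives

variable {E : Type*} [NormedAddCommGroup E] [NormedSpace ℝ E]
  {G : Type*} [TopologicalSpace G] [ChartedSpace E G] [Group G] {Γ : Subgroup G}
  [MeasurableSpace (G ⧸ Γ)] {ι : Type*} {ζ : ι → GroupLieAlgebra 𝓘(ℝ, E) G}

/-- `HasDerivBounds ζ k A R f`: all iterated derivatives of `f` in the directions `ζ i`, of every
order `l ≤ k`, exist, are measurable, and are bounded by `A * R ^ l`. The recursion peels off the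
innermost derivative. -/
def HasDerivBounds (ζ : ι → GroupLieAlgebra 𝓘(ℝ, E) G) :
    ℕ → ℝ → ℝ → (G ⧸ Γ → ℝ) → Prop
  | 0, A, _, f => Measurable f ∧ ∀ x, |f x| ≤ A
  | k + 1, A, R, f => (Measurable f ∧ ∀ x, |f x| ≤ A) ∧
      ∀ i, LieDifferentiable (ζ i) f ∧ HasDerivBounds ζ k (A * R) R (lieDeriv (ζ i) f)

theorem HasDerivBounds.zero_order {k : ℕ} {A R : ℝ} {f : G ⧸ Γ → ℝ}
    (h : HasDerivBounds ζ k A R f) : Measurable f ∧ ∀ x, |f x| ≤ A := by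
  cases k with
  | zero => exact h
  | succ k => exact h.1

theorem HasDerivBounds.of_succ {k : ℕ} {A R : ℝ} {f : G ⧸ Γ → ℝ}
    (h : HasDerivBounds ζ (k + 1) A R f) : HasDerivBounds ζ k A R f := by
  induction k generalizing A f with
  | zero => exact h.1
  | succ k ih => exact ⟨h.1, fun i => ⟨(h.2 i).1, ih (h.2 i).2⟩⟩

theorem HasDerivBounds.mono {k : ℕ} {A A' R R' : ℝ} {f : G ⧸ Γ → ℝ}
    (h : HasDerivBounds ζ k A R f) (hA : A ≤ A') (hA' : 0 ≤ A') (hR : 0 ≤ R) (hR' : R ≤ R') :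
    HasDerivBounds ζ k A' R' f := by
  induction k generalizing A A' f with
  | zero => exact ⟨h.1, fun x => (h.2 x).trans hA⟩
  | succ k ih =>
    refine ⟨⟨h.1.1, fun x => (h.1.2 x).trans hA⟩, fun i => ⟨(h.2 i).1, ih (h.2 i).2 ?_ ?_⟩⟩
    · exact (mul_le_mul_of_nonneg_right hA hR).trans (mul_le_mul_of_nonneg_left hR' hA')
    · exact mul_nonneg hA' (hR.trans hR')

/-- A uniform bound on all derivatives becomes a geometric one with amplitude given by the bound
on the function alone. -/
theorem HasDerivBounds.of_uniform {k : ℕ} {A C R : ℝ} {f : G ⧸ Γ → ℝ}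
    (h : HasDerivBounds ζ k C 1 f) (hA : 1 ≤ A) (hf : ∀ x, |f x| ≤ A) (hR : 1 ≤ R) (hC : C ≤ R) :
    HasDerivBounds ζ k A R f := by
  cases k with
  | zero => exact ⟨h.1, hf⟩
  | succ k =>
    refine ⟨⟨h.1.1, hf⟩, fun i => ⟨(h.2 i).1, (h.2 i).2.mono ?_ ?_ zero_le_one hR⟩⟩
    · rw [mul_one]; nlinarith
    · nlinarith

theorem HasDerivBounds.iterLieDeriv {k : ℕ} {A R : ℝ} {f : G ⧸ Γ → ℝ}
    (h : HasDerivBounds ζ k A R f) (L : List ι) (hL : L.length ≤ k) :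
    HasDerivBounds ζ (k - L.length) (A * R ^ L.length) R (iterLieDeriv ζ L f) := by
  induction L with
  | nil => simpa [Homogeneous.iterLieDeriv] using h
  | cons i L ih =>
    rw [List.length_cons] at hL ⊢
    have h' := ih (by omega)
    rw [show k - L.length = (k - (L.length + 1)) + 1 by omega] at h'
    rw [pow_succ, ← mul_assoc]
    exact (h'.2 i).2

theorem HasDerivBounds.lieDifferentiable_iterLieDeriv {k : ℕ} {A R : ℝ} {f : G ⧸ Γ → ℝ}
    (h : HasDerivBounds ζ k A R f) (L : List ι) (hL : L.length < k) (i : ι) :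
    LieDifferentiable (ζ i) (Homogeneous.iterLieDeriv ζ L f) := by
  have h' := h.iterLieDeriv L hL.le
  rw [show k - L.length = (k - (L.length + 1)) + 1 by omega] at h'
  exact (h'.2 i).1

theorem HasDerivBounds.memSobolev {μ : Measure (G ⧸ Γ)} [IsFiniteMeasure μ] {k : ℕ} {A R : ℝ}
    {f : G ⧸ Γ → ℝ} (h : HasDerivBounds ζ k A R f) : MemSobolev μ ζ k f :=
  ⟨fun L hL i => h.lieDifferentiable_iterLieDeriv L hL i, fun L hL =>
    have h' := (h.iterLieDeriv L hL).zero_order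
    MemLp.of_bound h'.1.aestronglyMeasurable _ (ae_of_all _ h'.2)⟩

theorem HasDerivBounds.sobolevNorm_le [Fintype ι] {μ : Measure (G ⧸ Γ)} [IsProbabilityMeasure μ]
    {k : ℕ} {A R : ℝ} {f : G ⧸ Γ → ℝ} (h : HasDerivBounds ζ k A R f) (hA : 0 ≤ A) (hR : 1 ≤ R) :
    sobolevNorm μ ζ k f ≤
      √(∑ l ∈ Finset.range (k + 1), (Fintype.card ι : ℝ) ^ l) * (A * R ^ k) := by
  have hAR : 0 ≤ A * R ^ k := by positivity
  rw [sobolevNorm, ← Real.sqrt_sq hAR, ← Real.sqrt_mul (Finset.sum_nonneg fun _ _ => by positivity)]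
  refine Real.sqrt_le_sqrt ?_
  rw [Finset.sum_mul]
  refine Finset.sum_le_sum fun l hl => ?_
  rw [Finset.mem_range, Nat.lt_succ_iff] at hl
  have hn : ∀ n : Fin l → ι,
      (eLpNorm (Homogeneous.iterLieDeriv ζ (List.ofFn n) f) 2 μ).toReal ^ 2 ≤ (A * R ^ k) ^ 2 := by
    intro n
    refine pow_le_pow_left₀ ENNReal.toReal_nonneg ?_ 2
    have h' := (h.iterLieDeriv (List.ofFn n) (by simpa using hl)).zero_order
    have := eLpNorm_le_of_ae_bound (p := 2) (μ := μ)
      (f := Homogeneous.iterLieDeriv ζ (List.ofFn n) f) (ae_of_all μ fun x => h'.2 x)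
    simp only [measure_univ, ENNReal.one_rpow, one_mul, List.length_ofFn] at this
    refine (ENNReal.toReal_le_of_le_ofReal (by positivity) this).trans ?_
    exact mul_le_mul_of_nonneg_left (pow_le_pow_right₀ hR hl) hA
  refine (Finset.sum_le_sum fun n _ => hn n).trans_eq ?_
  simp

theorem HasDerivBounds.add {k : ℕ} {A A' R : ℝ} {f g : G ⧸ Γ → ℝ}
    (hf : HasDerivBounds ζ k A R f) (hg : HasDerivBounds ζ k A' R g) :
    HasDerivBounds ζ k (A + A') R (fun x => f x + g x) := by
  induction k generalizing A A' f g with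
  | zero => exact ⟨hf.1.add hg.1, fun x => (abs_add_le _ _).trans (add_le_add (hf.2 x) (hg.2 x))⟩
  | succ k ih =>
    refine ⟨⟨hf.1.1.add hg.1.1, fun x => (abs_add_le _ _).trans
      (add_le_add (hf.1.2 x) (hg.1.2 x))⟩,
      fun i => ⟨fun x => ((hf.2 i).1 x).add ((hg.2 i).1 x), ?_⟩⟩
    have e : lieDeriv (ζ i) (fun x => f x + g x) =
        fun x => lieDeriv (ζ i) f x + lieDeriv (ζ i) g x :=
      funext fun x => deriv_fun_add ((hf.2 i).1 x) ((hg.2 i).1 x)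
    rw [e, add_mul]
    exact ih (hf.2 i).2 (hg.2 i).2

theorem HasDerivBounds.const_mul {k : ℕ} {A R : ℝ} {f : G ⧸ Γ → ℝ}
    (hf : HasDerivBounds ζ k A R f) (b : ℝ) :
    HasDerivBounds ζ k (|b| * A) R (fun x => b * f x) := by
  induction k generalizing A f with
  | zero =>
    exact ⟨hf.1.const_mul b, fun x => by
      rw [abs_mul]; exact mul_le_mul_of_nonneg_left (hf.2 x) (abs_nonneg b)⟩
  | succ k ih =>
    refine ⟨⟨hf.1.1.const_mul b, fun x => by
      rw [abs_mul]; exact mul_le_mul_of_nonneg_left (hf.1.2 x) (abs_nonneg b)⟩,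
      fun i => ⟨fun x => ((hf.2 i).1 x).const_mul b, ?_⟩⟩
    have e : lieDeriv (ζ i) (fun x => b * f x) = fun x => b * lieDeriv (ζ i) f x :=
      funext fun x => deriv_const_mul b ((hf.2 i).1 x)
    rw [e, mul_assoc]
    exact ih (hf.2 i).2

theorem hasDerivBounds_const (k : ℕ) (b : ℝ) :
    HasDerivBounds ζ k |b| 0 (fun _ : G ⧸ Γ => b) := by
  induction k generalizing b with
  | zero => exact ⟨measurable_const, fun _ => le_rfl⟩
  | succ k ih =>
    refine ⟨⟨measurable_const, fun _ => le_rfl⟩, fun i => ⟨fun x => differentiableAt_const b, ?_⟩⟩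
    have e : lieDeriv (ζ i) (fun _ : G ⧸ Γ => b) = fun _ => 0 := funext fun x => deriv_const 0 b
    rw [e, mul_zero]
    simpa using ih 0

end BoundedDerivatives

theorem measurable_const_smul_quotient {G : Type*} [TopologicalSpace G] [Group G]
    [IsTopologicalGroup G] {Γ : Subgroup G} [MeasurableSpace (G ⧸ Γ)] [BorelSpace (G ⧸ Γ)] (g : G) :
    Measurable fun x : G ⧸ Γ => g • x :=
  (continuous_const_smul g).measurable

section Dynamics

variable {E : Type*} [NormedAddCommGroup E] [NormedSpace ℝ E] [FiniteDimensional ℝ E]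
  {G : Type*} [TopologicalSpace G] [T2Space G] [ChartedSpace E G] [Group G]
  [LieGroup 𝓘(ℝ, E) ∞ G] {Γ : Subgroup G}

theorem lieDeriv_mul {ξ : GroupLieAlgebra 𝓘(ℝ, E) G} {f g : G ⧸ Γ → ℝ}
    (hf : LieDifferentiable ξ f) (hg : LieDifferentiable ξ g) :
    lieDeriv ξ (fun x => f x * g x) = fun x => lieDeriv ξ f x * g x + f x * lieDeriv ξ g x := by
  funext x
  have h := deriv_fun_mul (hf x) (hg x)
  have h0 : lieExp E ((0 : ℝ) • ξ) = 1 := (isOneParameterSubgroup_lieExp ξ).map_zero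
  rw [h0, one_smul] at h
  exact h

variable [MeasurableSpace (G ⧸ Γ)] {ι : Type*} {ζ : ι → GroupLieAlgebra 𝓘(ℝ, E) G}

/-- By the Leibniz rule, products add the geometric growth rates of the derivative bounds. -/
theorem HasDerivBounds.mul {k : ℕ} {A A' R R' : ℝ} {f g : G ⧸ Γ → ℝ}
    (hf : HasDerivBounds ζ k A R f) (hg : HasDerivBounds ζ k A' R' g)
    (hA : 0 ≤ A) (hA' : 0 ≤ A') (hR : 0 ≤ R) (hR' : 0 ≤ R') :
    HasDerivBounds ζ k (A * A') (R + R') (fun x => f x * g x) := by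
  induction k generalizing A A' f g with
  | zero =>
    exact ⟨hf.1.mul hg.1, fun x => by
      rw [abs_mul]; exact mul_le_mul (hf.2 x) (hg.2 x) (abs_nonneg _) hA⟩
  | succ k ih =>
    refine ⟨⟨hf.1.1.mul hg.1.1, fun x => by
      rw [abs_mul]; exact mul_le_mul (hf.1.2 x) (hg.1.2 x) (abs_nonneg _) hA⟩,
      fun i => ⟨fun x => ((hf.2 i).1 x).mul ((hg.2 i).1 x), ?_⟩⟩
    rw [lieDeriv_mul (hf.2 i).1 (hg.2 i).1,
      show A * A' * (R + R') = A * R * A' + A * (A' * R') by ring]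
    exact (ih (hf.2 i).2 hg.of_succ (by positivity) hA').add
      (ih hf.of_succ (hg.2 i).2 hA (by positivity))

/-- Translating by an element whose adjoint action expands the directions `ζ i` by factors
at most `Λ` multiplies the growth rate of the derivative bounds by `Λ`. -/
theorem HasDerivBounds.comp_smul [BorelSpace (G ⧸ Γ)] {k : ℕ} {A R Λ : ℝ} {f : G ⧸ Γ → ℝ}
    (hf : HasDerivBounds ζ k A R f) (hA : 0 ≤ A) (hR : 0 ≤ R) {g : G} {lam : ι → ℝ}
    (hg : ∀ i, Ad E g (ζ i) = lam i • ζ i) (hlam : ∀ i, |lam i| ≤ Λ) (hΛ : 0 ≤ Λ) :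
    HasDerivBounds ζ k A (R * Λ) (fun x => f (g • x)) := by
  have := topologicalGroup_of_lieGroup 𝓘(ℝ, E) (G := G) ∞
  have hm := measurable_const_smul_quotient (Γ := Γ) g
  induction k generalizing A f with
  | zero => exact ⟨hf.1.comp hm, fun x => hf.2 _⟩
  | succ k ih =>
    refine ⟨⟨hf.1.1.comp hm, fun x => hf.1.2 _⟩, fun i => ?_⟩
    have e : ∀ x : G ⧸ Γ, (fun t : ℝ => f (g • lieExp E (t • ζ i) • x)) =
        (fun s : ℝ => f (lieExp E (s • ζ i) • g • x)) ∘ fun t => lam i * t := by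
      intro x
      funext t
      simp only [Function.comp_apply]
      rw [← mul_smul, mul_lieExp_smul (hg i) t, mul_smul]
    have hd : ∀ x : G ⧸ Γ, HasDerivAt (fun t : ℝ => f (g • lieExp E (t • ζ i) • x))
        (lam i * lieDeriv (ζ i) f (g • x)) 0 := by
      intro x
      rw [e x, mul_comm]
      have h1 : HasDerivAt (fun t : ℝ => lam i * t) (lam i) 0 := by
        simpa using (hasDerivAt_id (0 : ℝ)).const_mul (lam i)
      refine HasDerivAt.comp (0 : ℝ) ?_ h1
      rw [mul_zero]
      exact ((hf.2 i).1 (g • x)).hasDerivAt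
    refine ⟨fun x => (hd x).differentiableAt, ?_⟩
    have e' : lieDeriv (ζ i) (fun x => f (g • x)) =
        fun x => lam i * lieDeriv (ζ i) f (g • x) := funext fun x => (hd x).deriv
    rw [e']
    refine ((ih (hf.2 i).2 (by positivity)).const_mul (lam i)).mono ?_ (by positivity)
      (by positivity) le_rfl
    calc |lam i| * (A * R) ≤ Λ * (A * R) := mul_le_mul_of_nonneg_right (hlam i) (by positivity)
      _ = A * (R * Λ) := by ring

end Dynamics

/-! ### Smooth weighted averages over translates -/

section LeftInvariantDerivative

variable {E : Type*} [NormedAddCommGroup E] [NormedSpace ℝ E]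
  {G : Type*} [TopologicalSpace G] [ChartedSpace E G] [Group G]

/-- The derivative of `θ : G → ℝ` along the left-invariant vector field with value `ξ` at the
identity. -/
noncomputable def leftInvDeriv (ξ : GroupLieAlgebra 𝓘(ℝ, E) G) (θ : G → ℝ) (g : G) : ℝ :=
  (mfderiv 𝓘(ℝ, E) 𝓘(ℝ, ℝ) θ g (mulInvariantVectorField ξ g) : ℝ)

theorem hasCompactSupport_leftInvDeriv {θ : G → ℝ} (hθ : HasCompactSupport θ)
    (ξ : GroupLieAlgebra 𝓘(ℝ, E) G) : HasCompactSupport (leftInvDeriv ξ θ) := by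
  refine hθ.mono' ?_
  intro g hg
  by_contra h
  refine hg ?_
  have e : θ =ᶠ[𝓝 g] fun _ => (0 : ℝ) := notMem_tsupport_iff_eventuallyEq.1 h
  rw [leftInvDeriv, e.mfderiv_eq, mfderiv_const]
  rfl

variable [LieGroup 𝓘(ℝ, E) ∞ G]

theorem contMDiff_leftInvDeriv {θ : G → ℝ} (hθ : ContMDiff 𝓘(ℝ, E) 𝓘(ℝ, ℝ) ∞ θ)
    (ξ : GroupLieAlgebra 𝓘(ℝ, E) G) : ContMDiff 𝓘(ℝ, E) 𝓘(ℝ, ℝ) ∞ (leftInvDeriv ξ θ) := by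
  have h1 := (ContMDiff.contMDiff_tangentMap hθ (m := ∞) (by simp)).comp
    (contMDiff_mulInvariantVectorField_infty ξ)
  have h2 := contMDiff_snd_tangentBundle_modelSpace ℝ 𝓘(ℝ, ℝ) (n := ∞)
  exact h2.comp h1

variable [FiniteDimensional ℝ E] [T2Space G]

theorem hasDerivAt_mul_lieExp {θ : G → ℝ} (hθ : ContMDiff 𝓘(ℝ, E) 𝓘(ℝ, ℝ) ∞ θ)
    (ξ : GroupLieAlgebra 𝓘(ℝ, E) G) (g : G) (s : ℝ) :
    HasDerivAt (fun s : ℝ => θ (g * lieExp E (s • ξ)))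
      (leftInvDeriv ξ θ (g * lieExp E (s • ξ))) s := by
  have hI := isMIntegralCurve_mul_left (((isOneParameterSubgroup_lieExp ξ).isMIntegralCurve
    (hasInitialVelocity_lieExp ξ)).isMIntegralCurveOn Set.univ) g
  have h1 := isMIntegralCurve_iff_isMIntegralCurveOn.2 hI s
  have h2 := (hθ.mdifferentiableAt (x := g * lieExp E (s • ξ)) (by simp)).hasMFDerivAt
  let L : ℝ →L[ℝ] ℝ := ContinuousLinearMap.comp
    (mfderiv 𝓘(ℝ, E) 𝓘(ℝ, ℝ) θ (g * lieExp E (s • ξ)) : E →L[ℝ] ℝ)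
    ((1 : ℝ →L[ℝ] ℝ).smulRight (mulInvariantVectorField ξ (g * lieExp E (s • ξ)) : E))
  have h3 : HasFDerivAt (fun s : ℝ => θ (g * lieExp E (s • ξ))) L s :=
    (HasMFDerivAt.comp (f := fun s : ℝ => g * lieExp E (s • ξ)) s h2 h1).hasFDerivAt
  refine h3.hasDerivAt.congr_deriv ?_
  exact congrArg (mfderiv 𝓘(ℝ, E) 𝓘(ℝ, ℝ) θ (g * lieExp E (s • ξ)) : E →L[ℝ] ℝ)
    (one_smul ℝ (mulInvariantVectorField ξ (g * lieExp E (s • ξ)) : E))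

end LeftInvariantDerivative

section Averages

variable {G : Type*} [Group G] {Γ : Subgroup G} [MeasurableSpace G]

/-- The average of `χ : G ⧸ Γ → ℝ` over translates, with weight `θ` with respect to `ν`. -/
noncomputable def weightedAverage (ν : Measure G) (θ : G → ℝ) (χ : G ⧸ Γ → ℝ) (x : G ⧸ Γ) : ℝ :=
  ∫ g, θ g * χ (g • x) ∂ν

theorem abs_weightedAverage_le {ν : Measure G} {θ : G → ℝ} (hθ : Integrable θ ν) {χ : G ⧸ Γ → ℝ}
    (hχ1 : ∀ x, |χ x| ≤ 1) (x : G ⧸ Γ) :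
    |weightedAverage ν θ χ x| ≤ ∫ g, |θ g| ∂ν := by
  rw [weightedAverage, ← Real.norm_eq_abs]
  refine norm_integral_le_of_norm_le hθ.abs (ae_of_all _ fun g => ?_)
  rw [norm_mul]
  exact mul_le_of_le_one_right (norm_nonneg _) (hχ1 _)

/-- Right invariance of `ν` transfers a translation of the point to the weight. -/
theorem weightedAverage_smul [MeasurableMul G] {ν : Measure G} [ν.IsMulRightInvariant]
    (θ : G → ℝ) (χ : G ⧸ Γ → ℝ) (h : G) (x : G ⧸ Γ) :
    weightedAverage ν θ χ (h • x) = ∫ g, θ (g * h⁻¹) * χ (g • x) ∂ν := by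
  rw [weightedAverage, ← integral_mul_right_eq_self (fun g => θ (g * h⁻¹) * χ (g • x)) h]
  simp [mul_smul]

variable [TopologicalSpace G] [IsTopologicalGroup G] [BorelSpace G]
  [MeasurableSpace (G ⧸ Γ)] [BorelSpace (G ⧸ Γ)] {ν : Measure G}

theorem integrable_mul_comp_smul {θ : G → ℝ} (hθ : Integrable θ ν) {χ : G ⧸ Γ → ℝ}
    (hχ : Measurable χ) (hχ1 : ∀ x, |χ x| ≤ 1) (x : G ⧸ Γ) :
    Integrable (fun g => θ g * χ (g • x)) ν := by
  have hm : Measurable fun g : G => χ (g • x) :=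
    hχ.comp (continuous_id.smul continuous_const).measurable
  exact hθ.mul_bdd (c := 1) hm.aestronglyMeasurable (ae_of_all _ fun g => hχ1 _)

variable [SecondCountableTopology G]

theorem measurable_smul_mk : Measurable fun p : (G ⧸ Γ) × G => p.2 • p.1 :=
  (continuous_snd.smul continuous_fst).measurable

theorem measurable_weightedAverage [SFinite ν] {θ : G → ℝ} (hθ : Measurable θ) {χ : G ⧸ Γ → ℝ}
    (hχ : Measurable χ) : Measurable (weightedAverage ν θ χ) := by
  have h : Measurable fun p : (G ⧸ Γ) × G => θ p.2 * χ (p.2 • p.1) :=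
    (hθ.comp measurable_snd).mul (hχ.comp measurable_smul_mk)
  exact h.stronglyMeasurable.integral_prod_right'.measurable

end Averages

section SmoothAverages

variable {E : Type*} [NormedAddCommGroup E] [NormedSpace ℝ E] [FiniteDimensional ℝ E]
  {G : Type*} [TopologicalSpace G] [T2Space G] [ChartedSpace E G] [Group G]
  [LieGroup 𝓘(ℝ, E) ∞ G] [MeasurableSpace G] [BorelSpace G]
  {Γ : Subgroup G} [MeasurableSpace (G ⧸ Γ)] [BorelSpace (G ⧸ Γ)]
  {ν : Measure G} [IsFiniteMeasureOnCompacts ν] [ν.IsMulRightInvariant]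

/-- Differentiating a weighted average moves the derivative to the weight. -/
theorem hasDerivAt_weightedAverage {θ : G → ℝ} (hθ : ContMDiff 𝓘(ℝ, E) 𝓘(ℝ, ℝ) ∞ θ)
    (hc : HasCompactSupport θ) {χ : G ⧸ Γ → ℝ} (hχ : Measurable χ) (hχ1 : ∀ x, |χ x| ≤ 1)
    (ξ : GroupLieAlgebra 𝓘(ℝ, E) G) (x : G ⧸ Γ) :
    HasDerivAt (fun s : ℝ => weightedAverage ν θ χ (lieExp E (s • ξ) • x))
      (weightedAverage ν (fun g => - leftInvDeriv ξ θ g) χ x) 0 := by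
  have := topologicalGroup_of_lieGroup 𝓘(ℝ, E) (G := G) ∞
  have hexp := isOneParameterSubgroup_lieExp ξ
  set c : ℝ → G := fun t => lieExp E (t • ξ) with hcdef
  have hθ' := contMDiff_leftInvDeriv hθ ξ
  have hc' := hasCompactSupport_leftInvDeriv hc ξ
  obtain ⟨M, hM⟩ := hc'.exists_bound_of_continuous hθ'.continuous
  -- for small times the weights are supported in one compact set
  let K : Set G := (fun p : G × ℝ => p.1 * (c (-p.2))⁻¹) ''
    (tsupport (leftInvDeriv ξ θ) ×ˢ Set.Icc (-1) 1)
  have hK : IsCompact K := by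
    refine (hc'.isCompact.prod isCompact_Icc).image ?_
    exact continuous_fst.mul (hexp.continuous.comp continuous_snd.neg).inv
  have e : (fun s : ℝ => weightedAverage ν θ χ (c s • x)) =
      fun s => ∫ g, θ (g * c (-s)) * χ (g • x) ∂ν := by
    funext s
    rw [weightedAverage_smul, hexp.map_neg]
  have hm : Measurable fun g : G => χ (g • x) :=
    hχ.comp (continuous_id.smul continuous_const).measurable
  have hd : ∀ (g : G) (s : ℝ), HasDerivAt (fun s : ℝ => θ (g * c (-s)) * χ (g • x))
      (-leftInvDeriv ξ θ (g * c (-s)) * χ (g • x)) s := by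
    intro g s
    have h := (hasDerivAt_mul_lieExp hθ ξ g (-s)).comp s (hasDerivAt_neg s)
    rw [mul_neg_one] at h
    exact h.mul_const _
  have key := hasDerivAt_integral_of_dominated_loc_of_deriv_le (μ := ν) (𝕜 := ℝ)
    (F := fun (s : ℝ) g => θ (g * c (-s)) * χ (g • x))
    (F' := fun s g => -leftInvDeriv ξ θ (g * c (-s)) * χ (g • x)) (x₀ := 0)
    (s := Set.Icc (-1) 1) (bound := K.indicator fun _ => M)
    (Icc_mem_nhds (by norm_num) (by norm_num))
    (Eventually.of_forall fun s => ((hθ.continuous.comp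
      (continuous_id.mul continuous_const)).measurable.mul hm).aestronglyMeasurable)
    ?_ ?_ ?_ ?_ ?_
  · have h := key.2
    change HasDerivAt (fun s : ℝ => weightedAverage ν θ χ (c s • x)) _ 0
    rw [e]
    refine h.congr_deriv ?_
    simp only [neg_zero, hexp.map_zero, mul_one, weightedAverage]
  · simp only [neg_zero, hexp.map_zero, mul_one]
    exact integrable_mul_comp_smul (hθ.continuous.integrable_of_hasCompactSupport hc) hχ hχ1 x
  · exact ((hθ'.continuous.comp
      (continuous_id.mul continuous_const)).neg.measurable.mul hm).aestronglyMeasurable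
  · refine ae_of_all _ fun g s hs => ?_
    by_cases hg : g ∈ K
    · rw [Set.indicator_of_mem hg, norm_mul, norm_neg]
      exact (mul_le_of_le_one_right (norm_nonneg _) (hχ1 _)).trans (hM _)
    · have : leftInvDeriv ξ θ (g * c (-s)) = 0 := by
        by_contra h
        exact hg ⟨(g * c (-s), s), ⟨subset_tsupport _ h, hs⟩, by simp⟩
      rw [Set.indicator_of_notMem hg, this]
      simp
  · exact (integrable_indicator_iff hK.measurableSet).2 (integrableOn_const hK.measure_lt_top.ne)
  · exact ae_of_all _ fun g s _ => hd g s

/-- The derivative bounds of a weighted average depend on the weight alone. -/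
theorem exists_hasDerivBounds_weightedAverage [SecondCountableTopology G] [SFinite ν]
    {ι : Type*} [Finite ι]
    (ζ : ι → GroupLieAlgebra 𝓘(ℝ, E) G) (k : ℕ) {θ : G → ℝ}
    (hθ : ContMDiff 𝓘(ℝ, E) 𝓘(ℝ, ℝ) ∞ θ) (hc : HasCompactSupport θ) :
    ∃ C : ℝ, ∀ χ : G ⧸ Γ → ℝ, Measurable χ → (∀ x, |χ x| ≤ 1) →
      HasDerivBounds ζ k C 1 (weightedAverage ν θ χ) := by
  have := topologicalGroup_of_lieGroup 𝓘(ℝ, E) (G := G) ∞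
  have := Fintype.ofFinite ι
  induction k generalizing θ with
  | zero =>
    exact ⟨∫ g, |θ g| ∂ν, fun χ hχ hχ1 => ⟨measurable_weightedAverage hθ.continuous.measurable hχ,
      abs_weightedAverage_le (hθ.continuous.integrable_of_hasCompactSupport hc) hχ1⟩⟩
  | succ k ih =>
    have h : ∀ i, ∃ C : ℝ, ∀ χ : G ⧸ Γ → ℝ, Measurable χ → (∀ x, |χ x| ≤ 1) →
        HasDerivBounds ζ k C 1 (weightedAverage ν (fun g => -leftInvDeriv (ζ i) θ g) χ) :=
      fun i => ih (contMDiff_leftInvDeriv hθ (ζ i)).neg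
        (hasCompactSupport_leftInvDeriv hc (ζ i)).neg
    choose C hC using h
    have h0 : 0 ≤ ∫ g, |θ g| ∂ν := integral_nonneg fun g => abs_nonneg _
    refine ⟨∫ g, |θ g| ∂ν + ∑ i, |C i|, fun χ hχ hχ1 => ⟨⟨measurable_weightedAverage
      hθ.continuous.measurable hχ, fun x => ?_⟩, fun i => ?_⟩⟩
    · refine (abs_weightedAverage_le (hθ.continuous.integrable_of_hasCompactSupport hc) hχ1 x).trans
        (le_add_of_nonneg_right (Finset.sum_nonneg fun i _ => abs_nonneg _))
    · have hd := hasDerivAt_weightedAverage (ν := ν) hθ hc hχ hχ1 (ζ i)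
      refine ⟨fun x => (hd x).differentiableAt, ?_⟩
      have e : lieDeriv (ζ i) (weightedAverage ν θ χ) =
          weightedAverage ν (fun g => -leftInvDeriv (ζ i) θ g) χ := funext fun x => (hd x).deriv
      rw [e]
      have hs : |C i| ≤ ∑ i, |C i| :=
        Finset.single_le_sum (f := fun i => |C i|) (fun i _ => abs_nonneg _) (Finset.mem_univ i)
      refine (hC i χ hχ hχ1).mono ?_ (by positivity) zero_le_one le_rfl
      linarith [le_abs_self (C i)]

end SmoothAverages

/-! ### The induced distance and smooth cut-offs of sublevel sets -/

section Distance

variable {E : Type*} [NormedAddCommGroup E] [NormedSpace ℝ E]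
  {G : Type*} [TopologicalSpace G] [ChartedSpace E G] [Group G] [LieGroup 𝓘(ℝ, E) ∞ G]
  {ρ : RiemannianMetricOn E G}

open scoped Bundle in
theorem eventually_groupEDist_lt (ρ : RiemannianMetricOn E G) (g : G) {c : ℝ≥0∞} (hc : 0 < c) :
    ∀ᶠ h in 𝓝 g, groupEDist ρ g h < c := by
  have hM : IsManifold 𝓘(ℝ, E) 1 G := IsManifold.of_le (n := ∞) (by simp)
  let : Bundle.RiemannianBundle (fun g : G => TangentSpace 𝓘(ℝ, E) g) := ⟨ρ.toRiemannianMetric⟩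
  have hcont : IsContinuousRiemannianBundle E (fun g : G => TangentSpace 𝓘(ℝ, E) g) :=
    ⟨ρ.inner, ρ.contMDiff.continuous, fun _ _ _ => rfl⟩
  exact eventually_riemannianEDist_lt 𝓘(ℝ, E) g hc

open scoped Bundle in
/-- Right translations map `C^1` paths to paths of the same length. -/
theorem IsRightInvariant.groupEDist_mul_right_le (hρ : IsRightInvariant ρ) (g g' h : G) :
    groupEDist ρ (g * h) (g' * h) ≤ groupEDist ρ g g' := by
  have hM : IsManifold 𝓘(ℝ, E) 1 G := IsManifold.of_le (n := ∞) (by simp)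
  let : Bundle.RiemannianBundle (fun g : G => TangentSpace 𝓘(ℝ, E) g) := ⟨ρ.toRiemannianMetric⟩
  refine le_of_forall_gt fun r hr => ?_
  obtain ⟨γ, h0, h1, hγ, hlen, -⟩ :=
    Manifold.exists_lt_locally_constant_of_riemannianEDist_lt hr zero_lt_one
  have hR : ContMDiff 𝓘(ℝ, E) 𝓘(ℝ, E) 1 (fun x : G => x * h) :=
    (contMDiff_mul_right (I := 𝓘(ℝ, E)) (n := ∞)).of_le (by simp)
  refine lt_of_le_of_lt (Manifold.riemannianEDist_le_pathELength (γ := fun t => γ t * h)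
    (a := 0) (b := 1) (hR.comp hγ).contMDiffOn (by simp [h0]) (by simp [h1]) zero_le_one) ?_
  refine lt_of_eq_of_lt ?_ hlen
  simp only [Manifold.pathELength]
  refine lintegral_congr fun t => ?_
  have e : mfderiv 𝓘(ℝ, ℝ) 𝓘(ℝ, E) (fun t => γ t * h) t (1 : ℝ) =
      mfderiv 𝓘(ℝ, E) 𝓘(ℝ, E) (fun x : G => x * h) (γ t) (mfderiv 𝓘(ℝ, ℝ) 𝓘(ℝ, E) γ t (1 : ℝ)) := by
    have := mfderiv_comp (I := 𝓘(ℝ, ℝ)) (I' := 𝓘(ℝ, E)) (I'' := 𝓘(ℝ, E)) t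
      (g := fun x : G => x * h) (f := γ) (hR.mdifferentiableAt (by simp))
      (hγ.mdifferentiableAt (by simp))
    exact congrArg (fun L : ℝ →L[ℝ] E => L 1) this
  rw [← ofReal_norm, ← ofReal_norm, norm_eq_sqrt_real_inner, norm_eq_sqrt_real_inner]
  congr 2
  refine Eq.trans ?_ (hρ (γ t) h _ _)
  exact congrArg (fun v : TangentSpace 𝓘(ℝ, E) (γ t * h) => ρ.inner (γ t * h) v v) e

theorem IsRightInvariant.quotientEDist_smul_le (hρ : IsRightInvariant ρ) {Γ : Subgroup G} (g : G)
    (x : G ⧸ Γ) : quotientEDist ρ Γ x (g • x) ≤ groupEDist ρ 1 g := by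
  induction x using QuotientGroup.induction_on with
  | H h =>
    have h1 : quotientEDist ρ Γ (h : G ⧸ Γ) (g • (h : G ⧸ Γ)) ≤ groupEDist ρ h (g * h) :=
      iInf₂_le_of_le h (g * h) (iInf₂_le_of_le rfl rfl le_rfl)
    have h2 := hρ.groupEDist_mul_right_le 1 g h
    rw [one_mul] at h2
    exact h1.trans h2

/-- Uniform continuity in terms of the group: small translations change `D` by little, uniformly on
the quotient. -/
theorem IsUniformlyContinuous.eventually_abs_sub_lt (hρ : IsRightInvariant ρ) {Γ : Subgroup G}
    {D : G ⧸ Γ → ℝ} (hD : IsUniformlyContinuous ρ D) {ε : ℝ} (hε : 0 < ε) :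
    ∀ᶠ g in 𝓝 (1 : G), ∀ x, |D x - D (g • x)| < ε := by
  obtain ⟨η, hη, h⟩ := hD ε hε
  filter_upwards [eventually_groupEDist_lt ρ 1 (ENNReal.ofReal_pos.2 hη)] with g hg x
  exact h _ _ ((hρ.quotientEDist_smul_le g x).trans_lt hg)

theorem IsUniformlyContinuous.continuous (hρ : IsRightInvariant ρ) {Γ : Subgroup G}
    {D : G ⧸ Γ → ℝ} (hD : IsUniformlyContinuous ρ D) : Continuous D := by
  have := topologicalGroup_of_lieGroup 𝓘(ℝ, E) (G := G) ∞
  refine continuous_iff_continuousAt.2 fun x => ?_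
  induction x using QuotientGroup.induction_on with
  | H h =>
    rw [ContinuousAt, QuotientGroup.nhds_eq, ← map_mul_right_nhds_one h, tendsto_map'_iff,
      tendsto_map'_iff, Metric.tendsto_nhds]
    intro ε hε
    filter_upwards [hD.eventually_abs_sub_lt hρ hε] with g hg
    rw [dist_comm, Real.dist_eq]
    exact hg h

end Distance

section CutOff

variable {E : Type*} [NormedAddCommGroup E] [NormedSpace ℝ E] [FiniteDimensional ℝ E]
  {G : Type*} [TopologicalSpace G] [T2Space G] [ChartedSpace E G] [Group G]
  [LieGroup 𝓘(ℝ, E) ∞ G]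

/-- A nonnegative smooth weight supported near the identity, normalised for a given measure. -/
theorem exists_smooth_weight [MeasurableSpace G] [BorelSpace G] (ν : Measure G)
    [IsFiniteMeasureOnCompacts ν] [ν.IsOpenPosMeasure] {U : Set G} (hU : U ∈ 𝓝 (1 : G)) :
    ∃ θ : G → ℝ, ContMDiff 𝓘(ℝ, E) 𝓘(ℝ, ℝ) ∞ θ ∧ HasCompactSupport θ ∧ (∀ g, 0 ≤ θ g) ∧
      (∀ g, θ g ≠ 0 → g ∈ U) ∧ ∫ g, θ g ∂ν = 1 := by
  obtain ⟨f, -, hf⟩ := (SmoothBumpFunction.nhds_basis_tsupport (I := 𝓘(ℝ, E)) (1 : G)).mem_iff.1 hU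
  have hi : 0 < ∫ g, f g ∂ν :=
    f.contMDiff.continuous.integral_pos_of_hasCompactSupport_nonneg_nonzero f.hasCompactSupport
      (fun g => f.nonneg) (x := 1) (by simp)
  refine ⟨fun g => (∫ g, f g ∂ν)⁻¹ * f g, contMDiff_const.mul f.contMDiff,
    f.hasCompactSupport.mul_left, fun g => mul_nonneg (inv_nonneg.2 hi.le) f.nonneg,
    fun g hg => hf (subset_tsupport _ (right_ne_zero_of_mul hg)), ?_⟩
  rw [integral_const_mul, inv_mul_cancel₀ hi.ne']

variable [SecondCountableTopology G]

/-- Smooth approximations of the indicator functions of sublevel sets of a uniformly continuous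
function, with derivative bounds that do not depend on the level. They are averages of the
indicator function over small translates. -/
theorem exists_smooth_cutOff {ρ : RiemannianMetricOn E G} (hρ : IsRightInvariant ρ)
    {Γ : Subgroup G} [MeasurableSpace (G ⧸ Γ)] [BorelSpace (G ⧸ Γ)] {D : G ⧸ Γ → ℝ}
    (hD : IsUniformlyContinuous ρ D) {ι : Type*} [Finite ι] (ζ : ι → GroupLieAlgebra 𝓘(ℝ, E) G)
    (k : ℕ) {ε : ℝ} (hε : 0 < ε) :
    ∃ R : ℝ, 1 ≤ R ∧ ∀ z : ℝ, ∃ φ : G ⧸ Γ → ℝ, HasDerivBounds ζ k 1 R φ ∧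
      (∀ x, 0 ≤ φ x) ∧ (∀ x, φ x ≤ 1) ∧ (∀ x, D x ≤ z - ε → φ x = 1) ∧
      (∀ x, z + ε < D x → φ x = 0) := by
  have := topologicalGroup_of_lieGroup 𝓘(ℝ, E) (G := G) ∞
  have : LocallyCompactSpace G := Manifold.locallyCompact_of_finiteDimensional 𝓘(ℝ, E)
  borelize G
  -- the Haar measure is left invariant, and inversion makes it right invariant
  let ν : Measure G := (Measure.haar : Measure G).inv
  obtain ⟨θ, hθ, hc, hθ0, hθU, hθ1⟩ := exists_smooth_weight (E := E) ν
    (hD.eventually_abs_sub_lt hρ hε)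
  have hint : Integrable θ ν := hθ.continuous.integrable_of_hasCompactSupport hc
  obtain ⟨C, hC⟩ := exists_hasDerivBounds_weightedAverage (Γ := Γ) (ν := ν) ζ k hθ hc
  refine ⟨max 1 C, le_max_left _ _, fun z => ?_⟩
  let χ : G ⧸ Γ → ℝ := {x | D x ≤ z}.indicator 1
  have hχm : Measurable χ :=
    measurable_one.indicator (measurableSet_le (hD.continuous hρ).measurable measurable_const)
  have hχ0 : ∀ x, 0 ≤ χ x := fun x => Set.indicator_nonneg (fun _ _ => zero_le_one) x
  have hχ1' : ∀ x, χ x ≤ 1 := fun x => Set.indicator_le_self' (fun _ _ => zero_le_one) x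
  have hχ1 : ∀ x, |χ x| ≤ 1 := fun x => by rw [abs_of_nonneg (hχ0 x)]; exact hχ1' x
  have h0 : ∀ x, 0 ≤ weightedAverage ν θ χ x := fun x =>
    integral_nonneg fun g => mul_nonneg (hθ0 g) (hχ0 _)
  have h1 : ∀ x, weightedAverage ν θ χ x ≤ 1 := fun x => by
    rw [← hθ1]
    exact integral_mono (integrable_mul_comp_smul hint hχm hχ1 x) hint
      fun g => mul_le_of_le_one_right (hθ0 g) (hχ1' _)
  refine ⟨weightedAverage ν θ χ, (hC χ hχm hχ1).of_uniform le_rfl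
    (fun x => by rw [abs_of_nonneg (h0 x)]; exact h1 x) (le_max_left _ _) (le_max_right _ _),
    h0, h1, fun x hx => ?_, fun x hx => ?_⟩
  · rw [← hθ1]
    refine integral_congr_ae (ae_of_all _ fun g => ?_)
    by_cases hg : θ g = 0
    · simp [hg]
    · have h := abs_lt.1 (hθU g hg x)
      have : g • x ∈ {x | D x ≤ z} := by
        rw [Set.mem_ofPred_eq]; linarith
      simp [χ, Set.indicator_of_mem this]
  · rw [weightedAverage, ← integral_zero G ℝ (μ := ν)]
    refine integral_congr_ae (ae_of_all _ fun g => ?_)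
    by_cases hg : θ g = 0
    · simp [hg]
    · have h := abs_lt.1 (hθU g hg x)
      have : g • x ∉ {x | D x ≤ z} := by
        rw [Set.mem_ofPred_eq]; linarith
      simp [χ, Set.indicator_of_notMem this]

end CutOff

/-! ### Multiple decorrelation along sparse times -/

section SparseTimes

/-- The quantitative content of the sparsity condition: eventually the times are positive and
increasing, grow at least linearly, and the exponent `δ * m (j + 1)` dominates `b * m j`. -/
theorem exists_sparse_constants {m : ℕ → ℝ} (hm_pos : ∀ᶠ j in atTop, 0 < m j) {δ b : ℝ}
    (hδ : 0 < δ)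
    (hm : limsup (fun j : ℕ => ((m j / m (j + 1) : ℝ) : EReal)) atTop <
      ((min 1 (δ / b) : ℝ) : EReal)) :
    0 < b ∧ ∃ κ : ℝ, 0 < κ ∧ ∃ c : ℝ, 0 < c ∧ ∃ J : ℕ, ∀ j, J ≤ j → 0 < m j ∧ m j ≤ m (j + 1) ∧
      κ * m (j + 1) ≤ δ * m (j + 1) - b * m j ∧ ∀ s : ℕ, c * s ≤ m (j + s) := by
  -- a number strictly between the upper limit and the bound makes both inequalities uniform
  obtain ⟨θ, h1, h2⟩ := EReal.lt_iff_exists_real_btwn.1 hm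
  rw [EReal.coe_lt_coe_iff, lt_min_iff] at h2
  have h3 := eventually_lt_of_limsup_lt h1
  obtain ⟨J, hJ⟩ := eventually_atTop.1 (h3.and hm_pos)
  have hpos : ∀ j, J ≤ j → 0 < m j := fun j hj => (hJ j hj).2
  have hlt : ∀ j, J ≤ j → m j < θ * m (j + 1) := fun j hj => by
    have := (hJ j hj).1
    rw [EReal.coe_lt_coe_iff, div_lt_iff₀ (hpos (j + 1) (by omega))] at this
    exact this
  have hθ : 0 < θ := by
    by_contra h
    nlinarith [hlt J le_rfl, hpos J le_rfl, hpos (J + 1) (by omega)]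
  have hb : 0 < b := by
    -- for `b ≤ 0` (with `δ / 0 = 0`) the minimum would not exceed `0 < θ`
    by_contra h
    linarith [div_nonpos_of_nonneg_of_nonpos hδ.le (not_lt.1 h)]
  have hθb : θ * b < δ := (lt_div_iff₀ hb).1 h2.2
  have hstep : ∀ j, J ≤ j → m j ≤ m (j + 1) := fun j hj => by
    nlinarith [hlt j hj, hpos (j + 1) (by omega)]
  have hmono : ∀ j, J ≤ j → m J ≤ m j := fun j hj => by
    induction j, hj using Nat.le_induction with
    | base => exact le_rfl
    | succ j hj ih => exact ih.trans (hstep j hj)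
  refine ⟨hb, δ - θ * b, by linarith, (1 - θ) * m J, mul_pos (by linarith) (hpos J le_rfl), J,
    fun j hj => ⟨hpos j hj, hstep j hj, ?_, fun s => ?_⟩⟩
  · nlinarith [hlt j hj]
  · induction s with
    | zero => simpa using (hpos j hj).le
    | succ s ih =>
      have h4 := hlt (j + s) (by omega)
      have h5 := hmono (j + s + 1) (by omega)
      rw [← add_assoc]
      push_cast
      nlinarith

end SparseTimes

section Decorrelation

variable {E : Type*} [NormedAddCommGroup E] [NormedSpace ℝ E] [FiniteDimensional ℝ E]
  {G : Type*} [TopologicalSpace G] [T2Space G] [ChartedSpace E G] [Group G]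
  [LieGroup 𝓘(ℝ, E) ∞ G] {Γ : Subgroup G} [MeasurableSpace (G ⧸ Γ)]
  [BorelSpace (G ⧸ Γ)] {ι : Type*} {ζ : ι → GroupLieAlgebra 𝓘(ℝ, E) G}

/-- Derivative bounds for the product of `φ` along `n` times in `[0, T]`: each factor contributes
`R * exp (Λ * T)` to the growth rate. -/
theorem HasDerivBounds.prod_comp_smul {a : ℝ → G} {γ : ι → ℝ}
    (hAd : ∀ (t : ℝ) (i : ι), Ad E (a t) (ζ i) = Real.exp (γ i * t) • ζ i)
    {Λ : ℝ} (hγ : ∀ i, γ i ≤ Λ) (hΛ : 0 ≤ Λ) {k : ℕ} {R : ℝ} (hR : 0 ≤ R) {φ : G ⧸ Γ → ℝ}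
    (hφ : HasDerivBounds ζ k 1 R φ) {t : ℕ → ℝ} {T : ℝ} {n : ℕ} (ht : ∀ i < n, 0 ≤ t i ∧ t i ≤ T) :
    HasDerivBounds ζ k 1 (n * (R * Real.exp (Λ * T)))
      (fun x => ∏ i ∈ Finset.range n, φ (a (t i) • x)) := by
  induction n with
  | zero => simpa using hasDerivBounds_const (ζ := ζ) (Γ := Γ) k 1
  | succ n ih =>
    have h1 := ih fun i hi => ht i (by omega)
    have h0 := ht n (by omega)
    have h2 := (hφ.comp_smul zero_le_one hR (hAd (t n)) (Λ := Real.exp (Λ * t n)) (fun i => by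
      rw [abs_of_pos (Real.exp_pos _), Real.exp_le_exp]
      exact mul_le_mul_of_nonneg_right (hγ i) h0.1) (Real.exp_pos _).le).mono
        (R' := R * Real.exp (Λ * T)) le_rfl zero_le_one (by positivity) (mul_le_mul_of_nonneg_left
          (Real.exp_le_exp.2 (mul_le_mul_of_nonneg_left h0.2 hΛ)) hR)
    have h3 := h1.mul h2 zero_le_one zero_le_one (by positivity) (by positivity)
    simp only [Finset.prod_range_succ]
    convert! h3 using 1
    · ring
    · push_cast; ring

variable {μ : Measure (G ⧸ Γ)} [IsProbabilityMeasure μ]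

/-- Multiple decorrelation along sparse times. One factor is split off at a time: the derivatives
of the product of the earlier factors grow at most like `exp (k * Λ * m j)`, which the mixing rate
at the next time beats. -/
theorem exists_decorrelation_bound [Fintype ι] {a : ℝ → G} {γ : ι → ℝ}
    (hAd : ∀ (t : ℝ) (i : ι), Ad E (a t) (ζ i) = Real.exp (γ i * t) • ζ i)
    {Λ : ℝ} (hγ : ∀ i, γ i ≤ Λ) (hΛ : 0 ≤ Λ) {k : ℕ} {δ : ℝ} (hmix : HasExpDecay μ ζ a k δ)
    {m : ℕ → ℝ} {κ : ℝ} (hκ : 0 < κ) {J : ℕ} (hJ : ∀ j, J ≤ j → 0 < m j ∧ m j ≤ m (j + 1) ∧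
      κ * m (j + 1) ≤ δ * m (j + 1) - k * Λ * m j) {R : ℝ} (hR : 1 ≤ R) :
    ∃ C : ℝ, 0 ≤ C ∧ ∀ φ : G ⧸ Γ → ℝ, HasDerivBounds ζ k 1 R φ → (∀ x, 0 ≤ φ x) → (∀ x, φ x ≤ 1) →
      ∀ q n : ℕ, J ≤ q →
        |∫ x, ∏ i ∈ Finset.range n, φ (a (m (q + 1 + i)) • x) ∂μ - (∫ x, φ x ∂μ) ^ n| ≤
          C * (n : ℝ) ^ (k + 1) * Real.exp (-κ * m (q + 1)) := by
  obtain ⟨c, hc, hmix⟩ := hmix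
  set K := √(∑ l ∈ Finset.range (k + 1), (Fintype.card ι : ℝ) ^ l) with hK
  have hK0 : 0 ≤ K := Real.sqrt_nonneg _
  refine ⟨c * K ^ 2 * R ^ (2 * k), by positivity, fun φ hφ hφ0 hφ1 q n hq => ?_⟩
  have hmono : ∀ i, m (q + 1) ≤ m (q + 1 + i) := fun i => by
    induction i with
    | zero => exact le_rfl
    | succ i ih => exact ih.trans (hJ (q + 1 + i) (by omega)).2.1
  have hmono' : ∀ i n : ℕ, i ≤ n → m (q + i) ≤ m (q + n) := fun i n hin => by
    induction n, hin using Nat.le_induction with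
    | base => exact le_rfl
    | succ n hn ih => exact ih.trans (hJ (q + n) (by omega)).2.1
  have hI0 : 0 ≤ ∫ x, φ x ∂μ := integral_nonneg hφ0
  have hφi : Integrable φ μ := Integrable.of_bound hφ.zero_order.1.aestronglyMeasurable 1
    (ae_of_all _ hφ.zero_order.2)
  have hI1 : ∫ x, φ x ∂μ ≤ 1 := by
    simpa using integral_mono hφi (integrable_const (1 : ℝ)) hφ1
  induction n with
  | zero => simp
  | succ n ih =>
    set F : G ⧸ Γ → ℝ := fun x => ∏ i ∈ Finset.range n, φ (a (m (q + 1 + i)) • x) with hF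
    have hRT : 1 ≤ ((n : ℝ) + 1) * (R * Real.exp (Λ * m (q + n))) := by
      have h1 : 1 ≤ Real.exp (Λ * m (q + n)) :=
        Real.one_le_exp (mul_nonneg hΛ (hJ (q + n) (by omega)).1.le)
      have h2 : (1 : ℝ) ≤ n + 1 := by simp
      exact one_le_mul_of_one_le_of_one_le h2 (one_le_mul_of_one_le_of_one_le hR h1)
    have hFb : HasDerivBounds ζ k 1 (((n : ℝ) + 1) * (R * Real.exp (Λ * m (q + n)))) F := by
      refine (HasDerivBounds.prod_comp_smul hAd hγ hΛ (by linarith) hφ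
        (t := fun i => m (q + 1 + i)) (T := m (q + n)) fun i hi =>
          ⟨(hJ (q + 1 + i) (by omega)).1.le, ?_⟩).mono le_rfl zero_le_one (by positivity) ?_
      · have := hmono' (1 + i) n (by omega)
        rwa [← add_assoc] at this
      · exact mul_le_mul_of_nonneg_right (by simp) (by positivity)
    have hSF := hFb.sobolevNorm_le (μ := μ) zero_le_one hRT
    have hSφ := hφ.sobolevNorm_le (μ := μ) zero_le_one hR
    have hmn := hJ (q + n) (by omega)
    have hstep : |∫ x, F x * φ (a (m (q + n + 1)) • x) ∂μ - (∫ x, F x ∂μ) * ∫ x, φ x ∂μ| ≤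
        c * K ^ 2 * R ^ (2 * k) * ((n : ℝ) + 1) ^ k * Real.exp (-κ * m (q + 1)) := by
      have h := hmix F φ hFb.memSobolev hφ.memSobolev (m (q + n + 1))
        (hJ (q + n + 1) (by omega)).1.le
      refine h.trans ?_
      calc c * Real.exp (-δ * m (q + n + 1)) * sobolevNorm μ ζ k F * sobolevNorm μ ζ k φ
          ≤ c * Real.exp (-δ * m (q + n + 1)) *
              (K * (1 * (((n : ℝ) + 1) * (R * Real.exp (Λ * m (q + n)))) ^ k)) *
              (K * (1 * R ^ k)) := by
            refine mul_le_mul (mul_le_mul_of_nonneg_left hSF (by positivity)) hSφ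
              (Real.sqrt_nonneg _) (by positivity)
        _ = c * K ^ 2 * R ^ (2 * k) * ((n : ℝ) + 1) ^ k *
              Real.exp (-(δ * m (q + n + 1) - k * Λ * m (q + n))) := by
            have e : Real.exp (-(δ * m (q + n + 1) - k * Λ * m (q + n))) =
                Real.exp (-δ * m (q + n + 1)) * Real.exp (Λ * m (q + n)) ^ k := by
              rw [← Real.exp_nat_mul, ← Real.exp_add]
              congr 1
              ring
            rw [e, mul_pow, mul_pow, pow_mul, ← pow_mul, mul_comm 2 k, pow_mul]
            ring
        _ ≤ _ := by
            refine mul_le_mul_of_nonneg_left (Real.exp_le_exp.2 ?_) (by positivity)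
            have h1 := hmono n
            rw [show q + 1 + n = q + n + 1 by omega] at h1
            nlinarith [hmn.2.2]
    have e1 : ∀ x, ∏ i ∈ Finset.range (n + 1), φ (a (m (q + 1 + i)) • x) =
        F x * φ (a (m (q + n + 1)) • x) := fun x => by
      rw [Finset.prod_range_succ, show q + 1 + n = q + n + 1 by omega]
    simp only [e1]
    have e2 : ∫ x, F x * φ (a (m (q + n + 1)) • x) ∂μ - (∫ x, φ x ∂μ) ^ (n + 1) =
        (∫ x, F x * φ (a (m (q + n + 1)) • x) ∂μ - (∫ x, F x ∂μ) * ∫ x, φ x ∂μ) +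
          (∫ x, F x ∂μ - (∫ x, φ x ∂μ) ^ n) * ∫ x, φ x ∂μ := by ring
    rw [e2]
    refine (abs_add_le _ _).trans ?_
    have h2 : |(∫ x, F x ∂μ - (∫ x, φ x ∂μ) ^ n) * ∫ x, φ x ∂μ| ≤
        c * K ^ 2 * R ^ (2 * k) * (n : ℝ) ^ (k + 1) * Real.exp (-κ * m (q + 1)) := by
      rw [abs_mul, abs_of_nonneg hI0]
      exact (mul_le_of_le_one_right (abs_nonneg _) hI1).trans ih
    refine (add_le_add hstep h2).trans ?_
    rw [← add_mul, ← mul_add]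
    refine mul_le_mul_of_nonneg_right (mul_le_mul_of_nonneg_left ?_ (by positivity))
      (Real.exp_pos _).le
    push_cast
    have : (n : ℝ) ^ k ≤ ((n : ℝ) + 1) ^ k := pow_le_pow_left₀ (by positivity) (by linarith) k
    rw [pow_succ, pow_succ]
    nlinarith [mul_le_mul_of_nonneg_right this (Nat.cast_nonneg (α := ℝ) n)]

end Decorrelation

/-! ### Maxima over a window compared with independent trials -/

section Asymptotic

theorem tendsto_sqrt_pow_mul_exp_neg (j : ℕ) {b : ℝ} (hb : 0 < b) :
    Tendsto (fun N : ℕ => ((Nat.sqrt N : ℝ) + 1) ^ j * Real.exp (-b * Nat.sqrt N)) atTop (𝓝 0) := by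
  have hs : Tendsto (fun N : ℕ => ((Nat.sqrt N : ℝ) + 1)) atTop atTop := by
    refine tendsto_atTop_add_const_right _ _ (tendsto_natCast_atTop_atTop.comp ?_)
    exact tendsto_atTop.2 fun B => (eventually_ge_atTop (B * B)).mono fun N hN => Nat.le_sqrt.2 hN
  have h := ((isLittleO_pow_exp_pos_mul_atTop j hb).tendsto_div_nhds_zero.comp hs).const_mul
    (Real.exp b)
  rw [mul_zero] at h
  refine h.congr fun N => ?_
  simp only [Function.comp_apply]
  rw [div_eq_mul_inv, ← Real.exp_neg, mul_left_comm, ← Real.exp_add]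
  congr 2
  ring

theorem tendsto_sqrt_div : Tendsto (fun N : ℕ => (Nat.sqrt N : ℝ) / N) atTop (𝓝 0) := by
  have h : Tendsto (fun N : ℕ => (√(N : ℝ))⁻¹) atTop (𝓝 0) :=
    tendsto_inv_atTop_zero.comp (Real.tendsto_sqrt_atTop.comp tendsto_natCast_atTop_atTop)
  refine squeeze_zero (fun N => by positivity) (fun N => ?_) h
  rcases Nat.eq_zero_or_pos N with rfl | hN
  · simp
  · have hN' : (0 : ℝ) < N := by exact_mod_cast hN
    rw [div_le_iff₀ hN', inv_mul_eq_div, Real.div_sqrt]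
    exact Real.nat_sqrt_le_real_sqrt

/-- If `N` times the probability of exceedance is asymptotically at least `x`, then
`N - √N` independent trials all fail with probability at most `exp (-x)` in the limit. -/
theorem eventually_pow_lt_of_lower {x L : ℝ} (hL : Real.exp (-x) < L) {e : ℕ → ℝ}
    (he : Tendsto e atTop (𝓝 0)) :
    ∀ᶠ N : ℕ in atTop, ∀ τ : ℝ, τ ≤ 1 → x / N ≤ τ → (1 - τ) ^ (N - Nat.sqrt N) + e N < L := by
  have h : Tendsto (fun N : ℕ => Real.exp (-x * (1 - (Nat.sqrt N : ℝ) / N)) + e N) atTop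
      (𝓝 (Real.exp (-x * (1 - 0)) + 0)) :=
    ((Real.continuous_exp.tendsto _).comp
      ((tendsto_const_nhds.sub tendsto_sqrt_div).const_mul _)).add he
  rw [sub_zero, mul_one, add_zero] at h
  filter_upwards [h.eventually_lt_const hL, eventually_gt_atTop 0] with N hN hN0 τ hτ hx
  refine lt_of_le_of_lt (add_le_add_left ?_ _) hN
  have hN' : (N : ℝ) ≠ 0 := by exact_mod_cast hN0.ne'
  have h1 : 1 - τ ≤ Real.exp (-(x / N)) := by
    linarith [Real.add_one_le_exp (-(x / N))]
  refine (pow_le_pow_left₀ (by linarith) h1 _).trans_eq ?_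
  rw [← Real.exp_nat_mul, Nat.cast_sub (Nat.sqrt_le_self N)]
  congr 1
  field_simp

/-- If `N` times the probability of exceedance is asymptotically at most `y`, then `N - √N`
independent trials all fail with probability at least `exp (-y)` in the limit, even after the
loss `√N * τ'` with `τ'` of order `1 / N`. -/
theorem eventually_lt_pow_of_upper {y b L : ℝ} (hL : L < Real.exp (-y)) {e : ℕ → ℝ}
    (he : Tendsto e atTop (𝓝 0)) :
    ∀ᶠ N : ℕ in atTop, ∀ τ τ' : ℝ, 0 ≤ τ → τ ≤ y / N → τ' ≤ b / N →
      L < (1 - τ) ^ (N - Nat.sqrt N) - Nat.sqrt N * τ' - e N := by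
  have h : Tendsto (fun N : ℕ => (1 + -y / N) ^ N - (Nat.sqrt N : ℝ) / N * b - e N) atTop
      (𝓝 (Real.exp (-y) - 0 * b - 0)) :=
    ((Real.tendsto_one_add_div_pow_exp (-y)).sub (tendsto_sqrt_div.mul_const b)).sub he
  rw [zero_mul, sub_zero, sub_zero] at h
  have hy : ∀ᶠ N : ℕ in atTop, y ≤ N := tendsto_natCast_atTop_atTop.eventually_ge_atTop y
  filter_upwards [h.eventually_const_lt hL, eventually_gt_atTop 0, hy]
    with N hN hN0 hyN τ τ' hτ0 hτ hτ'
  refine hN.trans_le (sub_le_sub_right (sub_le_sub ?_ ?_) _)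
  · have hN' : (0 : ℝ) < N := by exact_mod_cast hN0
    have h1 : y / N ≤ 1 := (div_le_one hN').2 hyN
    calc (1 + -y / N) ^ N ≤ (1 - τ) ^ N :=
          pow_le_pow_left₀ (by rw [neg_div]; linarith) (by rw [neg_div]; linarith) _
      _ ≤ (1 - τ) ^ (N - Nat.sqrt N) :=
          pow_le_pow_of_le_one (by linarith) (by linarith) (Nat.sub_le _ _)
  · refine (mul_le_mul_of_nonneg_left hτ' (by positivity)).trans_eq ?_
    ring

end Asymptotic

section Windows

variable {X : Type*} [MeasurableSpace X] {μ : Measure X} [IsProbabilityMeasure μ]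

theorem one_sub_tail_le_measureReal_le {D : X → ℝ} (hD : Measurable D) (u : ℝ) :
    1 - tail μ D u ≤ μ.real {x | D x ≤ u} := by
  have h : μ.real {x | u ≤ D x} = 1 - μ.real {x | D x < u} := by
    rw [← probReal_compl_eq_one_sub (measurableSet_lt hD measurable_const)]
    congr 1
    ext x
    simp
  rw [tail, h]
  have : μ.real {x | D x < u} ≤ μ.real {x | D x ≤ u} := by
    refine measureReal_mono fun x hx => ?_
    simp only [Set.mem_ofPred_eq] at hx ⊢
    exact hx.le
  linarith

theorem measureReal_le_one_sub_tail {D : X → ℝ} (hD : Measurable D) {u u' : ℝ} (h : u < u') :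
    μ.real {x | D x ≤ u} ≤ 1 - tail μ D u' := by
  rw [tail, ← probReal_compl_eq_one_sub (measurableSet_le measurable_const hD)]
  refine measureReal_mono fun x hx => ?_
  simp only [Set.mem_ofPred_eq, Set.mem_compl_iff, not_le] at hx ⊢
  linarith

end Windows

section Windows

variable {E : Type*} [NormedAddCommGroup E] [NormedSpace ℝ E] [FiniteDimensional ℝ E]
  {G : Type*} [TopologicalSpace G] [T2Space G] [SecondCountableTopology G]
  [ChartedSpace E G] [Group G] [LieGroup 𝓘(ℝ, E) ∞ G] {Γ : Subgroup G}
  [MeasurableSpace (G ⧸ Γ)] [BorelSpace (G ⧸ Γ)]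
  {μ : Measure (G ⧸ Γ)} [IsProbabilityMeasure μ]

/-- Comparison of the distribution of the maximum over a window of `N` times with that of
independent trials. The first `√N` times are discarded, which costs at most `√N * tail μ D u`;
after them the times are so large that the error of decorrelation tends to zero uniformly in the
level `u`. -/
theorem exists_window_bounds [SMulInvariantMeasure G (G ⧸ Γ) μ] {ρ : RiemannianMetricOn E G}
    (hρ : IsRightInvariant ρ) {D : G ⧸ Γ → ℝ} (hD : IsUniformlyContinuous ρ D)
    {ι : Type*} [Fintype ι] {ζ : ι → GroupLieAlgebra 𝓘(ℝ, E) G} {a : ℝ → G} {γ : ι → ℝ}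
    (hAd : ∀ (t : ℝ) (i : ι), Ad E (a t) (ζ i) = Real.exp (γ i * t) • ζ i)
    {Λ : ℝ} (hγ : ∀ i, γ i ≤ Λ) (hΛ : 0 ≤ Λ) {k : ℕ} {δ : ℝ} (hmix : HasExpDecay μ ζ a k δ)
    {m : ℕ → ℝ} {κ : ℝ} (hκ : 0 < κ) {c : ℝ} (hc : 0 < c) {J : ℕ}
    (hJ : ∀ j, J ≤ j → 0 < m j ∧ m j ≤ m (j + 1) ∧
      κ * m (j + 1) ≤ δ * m (j + 1) - k * Λ * m j ∧ ∀ s : ℕ, c * s ≤ m (j + s))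
    {ε : ℝ} (hε : 0 < ε) :
    ∃ e : ℕ → ℝ, Tendsto e atTop (𝓝 0) ∧ ∀ p N : ℕ, J ≤ p → 0 < N → ∀ u : ℝ,
      μ.real {x | ∀ i < N, D (a (m (p + i)) • x) ≤ u} ≤
          (1 - tail μ D (u + 3 * ε)) ^ (N - Nat.sqrt N) + e N ∧
        (1 - tail μ D (u - 2 * ε)) ^ (N - Nat.sqrt N) - Nat.sqrt N * tail μ D u - e N ≤
          μ.real {x | ∀ i < N, D (a (m (p + i)) • x) ≤ u} := by
  have := topologicalGroup_of_lieGroup 𝓘(ℝ, E) (G := G) ∞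
  have hDm : Measurable D := (hD.continuous hρ).measurable
  have hDa : ∀ t, Measurable fun x => D (a t • x) := fun t =>
    hDm.comp (measurable_const_smul_quotient (a t))
  obtain ⟨R, hR, hcut⟩ := exists_smooth_cutOff hρ hD ζ k hε
  obtain ⟨C, hC, hdec⟩ := exists_decorrelation_bound hAd hγ hΛ hmix hκ
    (fun j hj => ⟨(hJ j hj).1, (hJ j hj).2.1, (hJ j hj).2.2.1⟩) hR
  refine ⟨fun N => C * (((Nat.sqrt N : ℝ) + 1) ^ (2 * (k + 1)) *
    Real.exp (-(κ * c) * Nat.sqrt N)), ?_, fun p N hp hN u => ?_⟩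
  · simpa using (tendsto_sqrt_pow_mul_exp_neg (2 * (k + 1)) (mul_pos hκ hc)).const_mul C
  set s := Nat.sqrt N with hs
  set n := N - s with hn
  have hs1 : 0 < s := Nat.sqrt_pos.2 hN
  have hsN : s ≤ N := Nat.sqrt_le_self N
  have hdec' : ∀ φ : G ⧸ Γ → ℝ, HasDerivBounds ζ k 1 R φ → (∀ x, 0 ≤ φ x) → (∀ x, φ x ≤ 1) →
      |∫ x, ∏ i ∈ Finset.range n, φ (a (m (p + s + i)) • x) ∂μ - (∫ x, φ x ∂μ) ^ n| ≤
        C * (((s : ℝ) + 1) ^ (2 * (k + 1)) * Real.exp (-(κ * c) * s)) := by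
    intro φ h h0 h1
    have h2 := hdec φ h h0 h1 (p + s - 1) n (by omega)
    rw [show p + s - 1 + 1 = p + s by omega] at h2
    refine h2.trans ?_
    rw [mul_assoc]
    refine mul_le_mul_of_nonneg_left (mul_le_mul ?_ ?_ (Real.exp_pos _).le (by positivity)) hC
    · rw [pow_mul]
      refine pow_le_pow_left₀ (by positivity) ?_ _
      have h3 : n ≤ (s + 1) ^ 2 := by
        have := Nat.lt_succ_sqrt N
        rw [pow_two]
        exact (Nat.sub_le _ _).trans this.le
      exact_mod_cast h3
    · refine Real.exp_le_exp.2 ?_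
      have := (hJ p hp).2.2.2 s
      nlinarith
  have hint : ∀ φ : G ⧸ Γ → ℝ, HasDerivBounds ζ k 1 R φ → Integrable φ μ := fun φ h =>
    Integrable.of_bound h.zero_order.1.aestronglyMeasurable 1 (ae_of_all _ h.zero_order.2)
  have hintF : ∀ φ : G ⧸ Γ → ℝ, HasDerivBounds ζ k 1 R φ →
      Integrable (fun x => ∏ i ∈ Finset.range n, φ (a (m (p + s + i)) • x)) μ := fun φ h => by
    refine Integrable.of_bound (Finset.measurable_prod _ fun i _ => h.zero_order.1.comp
      (measurable_const_smul_quotient _)).aestronglyMeasurable 1 (ae_of_all _ fun x => ?_)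
    rw [Real.norm_eq_abs, Finset.abs_prod]
    exact Finset.prod_le_one (fun i _ => abs_nonneg _) fun i _ => h.zero_order.2 _
  have hset : ∀ I : Set ℕ, MeasurableSet {x | ∀ i ∈ I, D (a (m (p + i)) • x) ≤ u} := fun I => by
    have : {x | ∀ i ∈ I, D (a (m (p + i)) • x) ≤ u} =
        ⋂ i ∈ I, {x | D (a (m (p + i)) • x) ≤ u} := by
      ext x; simp
    rw [this]
    exact MeasurableSet.biInter I.to_countable fun i _ => measurableSet_le (hDa _) measurable_const
  constructor
  -- upper bound: the cut-off equals `1` on `{D ≤ u}` and vanishes on `{D > u + 2 * ε}`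
  · obtain ⟨φ, hφ, hφ0, hφ1, hone, hzero⟩ := hcut (u + ε)
    have h1 : μ.real {x | ∀ i < N, D (a (m (p + i)) • x) ≤ u} ≤
        ∫ x, ∏ i ∈ Finset.range n, φ (a (m (p + s + i)) • x) ∂μ := by
      have hm : MeasurableSet {x | ∀ i < N, D (a (m (p + i)) • x) ≤ u} := hset {i | i < N}
      rw [← integral_indicator_one hm]
      refine integral_mono ((integrable_const 1).indicator hm) (hintF φ hφ) ?_
      refine fun x => Set.indicator_apply_le' (fun hx => ?_)
        fun _ => Finset.prod_nonneg fun i _ => hφ0 _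
      refine (Finset.prod_eq_one fun i hi => hone _ ?_).ge
      rw [Finset.mem_range] at hi
      have := hx (s + i) (show s + i < N by omega)
      rw [← add_assoc] at this
      linarith
    have h2 : ∫ x, φ x ∂μ ≤ 1 - tail μ D (u + 3 * ε) := by
      refine le_trans ?_ (measureReal_le_one_sub_tail (u := u + 2 * ε) hDm (by linarith))
      have hm : MeasurableSet {x | D x ≤ u + 2 * ε} := measurableSet_le hDm measurable_const
      rw [← integral_indicator_one hm]
      refine integral_mono (hint φ hφ) ((integrable_const 1).indicator hm) fun x => ?_
      by_cases hx : x ∈ {x | D x ≤ u + 2 * ε}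
      · rw [Set.indicator_of_mem hx]; exact hφ1 x
      · rw [Set.indicator_of_notMem hx]
        refine (hzero x ?_).le
        rw [Set.mem_ofPred_eq, not_le] at hx
        linarith
    have h3 := (abs_le.1 (hdec' φ hφ hφ0 hφ1)).2
    have h4 := pow_le_pow_left₀ (integral_nonneg hφ0) h2 n
    linarith
  -- lower bound: the cut-off vanishes on `{D > u}` and equals `1` on `{D ≤ u - 2 * ε}`
  · obtain ⟨φ, hφ, hφ0, hφ1, hone, hzero⟩ := hcut (u - ε)
    have h1 : ∫ x, ∏ i ∈ Finset.range n, φ (a (m (p + s + i)) • x) ∂μ ≤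
        μ.real {x | ∀ i ∈ Set.Ico s N, D (a (m (p + i)) • x) ≤ u} := by
      rw [← integral_indicator_one (hset _)]
      refine integral_mono (hintF φ hφ) ((integrable_const 1).indicator (hset _)) fun x => ?_
      by_cases hx : x ∈ {x | ∀ i ∈ Set.Ico s N, D (a (m (p + i)) • x) ≤ u}
      · rw [Set.indicator_of_mem hx]
        exact Finset.prod_le_one (fun i _ => hφ0 _) fun i _ => hφ1 _
      · rw [Set.indicator_of_notMem hx]
        simp only [Set.mem_ofPred_eq, not_forall, not_le] at hx
        obtain ⟨i, hi, hx⟩ := hx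
        refine (Finset.prod_eq_zero (i := i - s) ?_ (hzero _ ?_)).le
        · rw [Finset.mem_range]
          have := hi.1; have := hi.2
          omega
        · rw [add_assoc, Nat.add_sub_cancel' hi.1]
          linarith
    have h2 : 1 - tail μ D (u - 2 * ε) ≤ ∫ x, φ x ∂μ := by
      refine (one_sub_tail_le_measureReal_le hDm _).trans ?_
      have hm : MeasurableSet {x | D x ≤ u - 2 * ε} := measurableSet_le hDm measurable_const
      rw [← integral_indicator_one hm]
      refine integral_mono ((integrable_const 1).indicator hm) (hint φ hφ) fun x => ?_
      refine Set.indicator_apply_le' (fun hx => (hone x ?_).ge) fun _ => hφ0 x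
      rw [Set.mem_ofPred_eq] at hx
      linarith
    have h3 := (abs_le.1 (hdec' φ hφ hφ0 hφ1)).1
    have h4 : (1 - tail μ D (u - 2 * ε)) ^ n ≤ (∫ x, φ x ∂μ) ^ n :=
      pow_le_pow_left₀ (sub_nonneg.2 measureReal_le_one) h2 n
    have h5 : μ.real {x | ∀ i ∈ Set.Ico s N, D (a (m (p + i)) • x) ≤ u} ≤
        μ.real {x | ∀ i < N, D (a (m (p + i)) • x) ≤ u} + s * tail μ D u := by
      have hsub : {x | ∀ i ∈ Set.Ico s N, D (a (m (p + i)) • x) ≤ u} ⊆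
          {x | ∀ i < N, D (a (m (p + i)) • x) ≤ u} ∪
            ⋃ i ∈ Finset.range s, {x | u ≤ D (a (m (p + i)) • x)} := by
        intro x hx
        by_cases h : ∃ i < s, u ≤ D (a (m (p + i)) • x)
        · right
          simpa using h
        · left
          push Not at h
          intro i hi
          rcases lt_or_ge i s with his | his
          · exact (h i his).le
          · exact hx i ⟨his, hi⟩
      refine (measureReal_mono hsub).trans ((measureReal_union_le _ _).trans
        (add_le_add_right ((measureReal_biUnion_finset_le _ _).trans_eq ?_) _))
      have htail : ∀ i, μ.real {x | u ≤ D (a (m (p + i)) • x)} = tail μ D u := fun i => by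
        have h := (measurePreserving_smul (a (m (p + i))) μ).measureReal_preimage
          (measurableSet_le measurable_const hDm : MeasurableSet {x | u ≤ D x}).nullMeasurableSet
        exact h
      simp [htail]
    linarith

end Windows

/-! ### The extreme value law -/

section Limits

theorem IsSDL.eventually_tail_bounds {E : Type*} [NormedAddCommGroup E] [NormedSpace ℝ E]
    {G : Type*} [TopologicalSpace G] [ChartedSpace E G] [Group G] [LieGroup 𝓘(ℝ, E) ∞ G]
    {ρ : RiemannianMetricOn E G} {Γ : Subgroup G} [MeasurableSpace (G ⧸ Γ)]
    {μ : Measure (G ⧸ Γ)} {D : G ⧸ Γ → ℝ} {w v : ℝ} (h : IsSDL ρ μ D w v)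
    {η : ℝ} (hη : 0 < η) : ∀ᶠ z : ℝ in atTop, (w - η) * Real.exp (-v * z) ≤ tail μ D z ∧
      tail μ D z ≤ (w + η) * Real.exp (-v * z) := by
  filter_upwards [h.tail_isLittleO.def hη] with z hz
  rw [Real.norm_eq_abs, Real.norm_of_nonneg (Real.exp_pos _).le] at hz
  have := abs_le.1 hz
  constructor <;> linarith

variable {G : Type*} [Group G] {Γ : Subgroup G}

theorem setOf_windowMax_le {a : ℝ → G} {m : ℕ → ℝ} {D : G ⧸ Γ → ℝ} {p q : ℕ} (hpq : p < q)
    (u : ℝ) : {x | windowMax a m D hpq x ≤ u} =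
      {x | ∀ i < q - p + 1, D (a (m (p + i)) • x) ≤ u} := by
  ext x
  simp only [windowMax, Set.mem_ofPred_eq, Finset.sup'_le_iff, Finset.mem_Icc]
  constructor
  · intro h i hi
    exact h (p + i) (by omega)
  · intro h i hi
    have := h (i - p) (by omega)
    rwa [Nat.add_sub_cancel' hi.1] at this

/-- The level is normalised so that the exponential tail at it is of order `1 / N`. -/
theorem exp_neg_mul_level_add {v : ℝ} (hv : v ≠ 0) {p q : ℕ} (hpq : p < q) (r η : ℝ) :
    Real.exp (-v * (level v p q r + η)) = Real.exp (-v * (r + η)) / ((q - p + 1 : ℕ) : ℝ) := by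
  have hN : ((q - p + 1 : ℕ) : ℝ) = (q : ℝ) - p + 1 := by
    rw [Nat.cast_add, Nat.cast_sub hpq.le, Nat.cast_one]
  have hN0 : 0 < ((q - p + 1 : ℕ) : ℝ) := by positivity
  rw [level, ← hN]
  have e : -v * (r + 1 / v * Real.log ((q - p + 1 : ℕ) : ℝ) + η) =
      -v * (r + η) - Real.log ((q - p + 1 : ℕ) : ℝ) := by
    field_simp
    ring
  rw [e, Real.exp_sub, Real.exp_log hN0]

theorem tendsto_level {v : ℝ} (hv : 0 < v) {α β : ℕ → ℕ} (hαβ : ∀ n, α n < β n)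
    (hN : Tendsto (fun n => β n - α n) atTop atTop) (r : ℝ) :
    Tendsto (fun n => level v (α n) (β n) r) atTop atTop := by
  refine tendsto_atTop_add_const_left _ _ (Tendsto.const_mul_atTop (by positivity) ?_)
  refine Real.tendsto_log_atTop.comp (tendsto_atTop_add_const_right _ _ ?_)
  refine (tendsto_natCast_atTop_atTop.comp hN).congr fun n => ?_
  exact Nat.cast_sub (hαβ n).le

variable [MeasurableSpace (G ⧸ Γ)]

/-- For every `ε > 0`, the distribution of the maximum of `D (a_{m_i} x)` over `N` consecutive
indices is that of `N - √N` independent trials, up to a shift of the level by a multiple of `ε`,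
an error `√N * tail μ D u` in the lower bound, and an error depending on `N` only that tends to
zero. This is required for windows that start late enough. -/
def HasWindowBounds (μ : Measure (G ⧸ Γ)) (a : ℝ → G) (m : ℕ → ℝ) (D : G ⧸ Γ → ℝ) : Prop :=
  ∀ ε : ℝ, 0 < ε → ∃ e : ℕ → ℝ, Tendsto e atTop (𝓝 0) ∧ ∀ᶠ p in atTop, ∀ N : ℕ, 0 < N → ∀ u : ℝ,
      μ.real {x | ∀ i < N, D (a (m (p + i)) • x) ≤ u} ≤
          (1 - tail μ D (u + 3 * ε)) ^ (N - Nat.sqrt N) + e N ∧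
        (1 - tail μ D (u - 2 * ε)) ^ (N - Nat.sqrt N) - Nat.sqrt N * tail μ D u - e N ≤
          μ.real {x | ∀ i < N, D (a (m (p + i)) • x) ≤ u}

variable {μ : Measure (G ⧸ Γ)} {m : ℕ → ℝ} {a : ℝ → G} {D : G ⧸ Γ → ℝ}
  {α β : ℕ → ℕ}

/-- The upper half of the extreme value law, from a lower bound on the tail. -/
theorem HasWindowBounds.eventually_lt [IsProbabilityMeasure μ]
    (h : HasWindowBounds μ a m D) (hαβ : ∀ n, α n < β n)
    (hα : Tendsto α atTop atTop) (hN : Tendsto (fun n => β n - α n) atTop atTop)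
    {w v : ℝ} (hv : 0 < v) (hw : ∀ᶠ z : ℝ in atTop, w * Real.exp (-v * z) ≤ tail μ D z) (r : ℝ)
    {L : ℝ} (hL : Real.exp (-w * Real.exp (-v * r)) < L) :
    ∀ᶠ n in atTop, μ.real {x | windowMax a m D (hαβ n) x ≤ level v (α n) (β n) r} < L := by
  have hcont : Tendsto (fun ε : ℝ => Real.exp (-(w * Real.exp (-v * (r + 3 * ε))))) (𝓝[>] 0)
      (𝓝 (Real.exp (-w * Real.exp (-v * r)))) := by
    have hc : Continuous fun ε : ℝ => Real.exp (-(w * Real.exp (-v * (r + 3 * ε)))) := by fun_prop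
    have := hc.tendsto 0
    rw [mul_zero, add_zero, ← neg_mul] at this
    exact this.mono_left nhdsWithin_le_nhds
  obtain ⟨ε, hε, hε0⟩ := ((hcont.eventually_lt_const hL).and self_mem_nhdsWithin).exists
  obtain ⟨e, he, hb⟩ := h ε hε0
  have hN1 : Tendsto (fun n => β n - α n + 1) atTop atTop := (tendsto_add_atTop_nat 1).comp hN
  have hu : Tendsto (fun n => level v (α n) (β n) r + 3 * ε) atTop atTop :=
    tendsto_atTop_add_const_right _ _ (tendsto_level hv hαβ hN r)
  filter_upwards [hN1.eventually (eventually_pow_lt_of_lower hε he), hα.eventually hb,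
    hu.eventually hw] with n h1 h2 h3
  rw [setOf_windowMax_le]
  refine lt_of_le_of_lt (h2 _ (by omega) _).1 (h1 _ measureReal_le_one ?_)
  rwa [exp_neg_mul_level_add hv.ne' (hαβ n), ← mul_div_assoc] at h3

/-- The lower half of the extreme value law, from an upper bound on the tail. -/
theorem HasWindowBounds.eventually_gt (h : HasWindowBounds μ a m D) (hαβ : ∀ n, α n < β n)
    (hα : Tendsto α atTop atTop) (hN : Tendsto (fun n => β n - α n) atTop atTop)
    {w v : ℝ} (hv : 0 < v) (hw : ∀ᶠ z : ℝ in atTop, tail μ D z ≤ w * Real.exp (-v * z)) (r : ℝ)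
    {L : ℝ} (hL : L < Real.exp (-w * Real.exp (-v * r))) :
    ∀ᶠ n in atTop, L < μ.real {x | windowMax a m D (hαβ n) x ≤ level v (α n) (β n) r} := by
  have hcont : Tendsto (fun ε : ℝ => Real.exp (-(w * Real.exp (-v * (r + -(2 * ε)))))) (𝓝[>] 0)
      (𝓝 (Real.exp (-w * Real.exp (-v * r)))) := by
    have hc : Continuous fun ε : ℝ => Real.exp (-(w * Real.exp (-v * (r + -(2 * ε))))) := by
      fun_prop
    have := hc.tendsto 0
    rw [mul_zero, neg_zero, add_zero, ← neg_mul] at this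
    exact this.mono_left nhdsWithin_le_nhds
  obtain ⟨ε, hε, hε0⟩ := ((hcont.eventually_const_lt hL).and self_mem_nhdsWithin).exists
  obtain ⟨e, he, hb⟩ := h ε hε0
  have hN1 : Tendsto (fun n => β n - α n + 1) atTop atTop := (tendsto_add_atTop_nat 1).comp hN
  have hu := tendsto_level hv hαβ hN r
  have hu' : Tendsto (fun n => level v (α n) (β n) r + -(2 * ε)) atTop atTop :=
    tendsto_atTop_add_const_right _ _ hu
  filter_upwards [hN1.eventually (eventually_lt_pow_of_upper (b := w * Real.exp (-v * r)) hε he),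
    hα.eventually hb, hu.eventually hw, hu'.eventually hw] with n h1 h2 h3 h4
  rw [setOf_windowMax_le]
  refine lt_of_lt_of_le (h1 _ _ measureReal_nonneg ?_ ?_) (h2 _ (by omega) _).2
  · rwa [exp_neg_mul_level_add hv.ne' (hαβ n), ← mul_div_assoc] at h4
  · have := exp_neg_mul_level_add hv.ne' (hαβ n) r 0
    rw [add_zero, add_zero] at this
    rwa [this, ← mul_div_assoc] at h3

end Limits

end Homogeneous

theorem mainTheorem7
    {E : Type*} [NormedAddCommGroup E] [NormedSpace ℝ E] [FiniteDimensional ℝ E]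
    {G : Type*} [TopologicalSpace G] [T2Space G] [SecondCountableTopology G]
    [ChartedSpace E G] [Group G] [LieGroup 𝓘(ℝ, E) ∞ G]
    (ρ : Homogeneous.RiemannianMetricOn E G) (hρ : Homogeneous.IsRightInvariant ρ)
    (Γ : Subgroup G) [DiscreteTopology Γ]
    [MeasurableSpace (G ⧸ Γ)] [BorelSpace (G ⧸ Γ)]
    (μ : Measure (G ⧸ Γ)) [IsProbabilityMeasure μ] [SMulInvariantMeasure G (G ⧸ Γ) μ]
    (a : ℝ → G) (ha : Homogeneous.IsOneParameterSubgroup a)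
    {d : ℕ} (ζ : Module.Basis (Fin d) ℝ (GroupLieAlgebra 𝓘(ℝ, E) G)) (γ : Fin d → ℝ)
    (hAd : ∀ (t : ℝ) (i : Fin d), Homogeneous.Ad E (a t) (ζ i) = Real.exp (γ i * t) • ζ i)
    (k : ℕ) (hk : 0 < k) (δ : ℝ) (hδ : 0 < δ)
    (hmix : Homogeneous.HasExpDecay μ ζ a k δ)
    (m : ℕ → ℝ) (hm_pos : ∀ᶠ j in atTop, 0 < m j)
    (hm : limsup (fun j : ℕ => ((m j / m (j + 1) : ℝ) : EReal)) atTop <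
      ((min 1 (δ / (k * ⨆ i, γ i)) : ℝ) : EReal))
    (α β : ℕ → ℕ) (hαβ : ∀ n, α n < β n)
    (hα : Tendsto α atTop atTop) (hN : Tendsto (fun n => β n - α n) atTop atTop)
    (D : G ⧸ Γ → ℝ) :
    (∀ w v : ℝ, 0 < w → 0 < v → Homogeneous.IsSDL ρ μ D w v → ∀ r : ℝ,
      Tendsto
        (fun n => μ.real {x | Homogeneous.windowMax a m D (hαβ n) x ≤
          Homogeneous.level v (α n) (β n) r})
        atTop (𝓝 (Real.exp (-w * Real.exp (-v * r))))) ∧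
    (∀ w₁ w₂ v : ℝ, 0 < w₁ → 0 < w₂ → 0 < v → Homogeneous.IsDL ρ μ D w₁ w₂ v → ∀ r : ℝ,
      Real.exp (-w₂ * Real.exp (-v * r)) ≤
        liminf (fun n => μ.real {x | Homogeneous.windowMax a m D (hαβ n) x ≤
          Homogeneous.level v (α n) (β n) r}) atTop ∧
      liminf (fun n => μ.real {x | Homogeneous.windowMax a m D (hαβ n) x ≤
          Homogeneous.level v (α n) (β n) r}) atTop ≤
        limsup (fun n => μ.real {x | Homogeneous.windowMax a m D (hαβ n) x ≤
          Homogeneous.level v (α n) (β n) r}) atTop ∧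
      limsup (fun n => μ.real {x | Homogeneous.windowMax a m D (hαβ n) x ≤
          Homogeneous.level v (α n) (β n) r}) atTop ≤
        Real.exp (-w₁ * Real.exp (-v * r))) := by
  obtain ⟨hb, κ, hκ, c, hc, J, hJ⟩ := Homogeneous.exists_sparse_constants hm_pos hδ hm
  have hΛ : 0 ≤ ⨆ i, γ i := (pos_of_mul_pos_right hb (Nat.cast_nonneg k)).le
  have key : Homogeneous.IsUniformlyContinuous ρ D → Homogeneous.HasWindowBounds μ a m D := by
    intro hD ε hε
    obtain ⟨e, he, h⟩ := Homogeneous.exists_window_bounds hρ hD hAd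
      (fun i => le_ciSup (Set.finite_range γ).bddAbove i) hΛ hmix hκ hc hJ hε
    exact ⟨e, he, (eventually_ge_atTop J).mono fun p hp N => h p N hp⟩
  refine ⟨fun w v hw hv hD r => ?_, fun w₁ w₂ v hw₁ hw₂ hv hD r => ?_⟩
  · have h := key hD.uniformlyContinuous
    have hcont : Tendsto (fun η : ℝ => Real.exp (-η * Real.exp (-v * r))) (𝓝 w)
        (𝓝 (Real.exp (-w * Real.exp (-v * r)))) :=
      (by fun_prop : Continuous fun η : ℝ => Real.exp (-η * Real.exp (-v * r))).tendsto w
    have hplus : Tendsto (fun η : ℝ => w + η) (𝓝[>] 0) (𝓝 w) := by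
      have := (continuous_const_add w).tendsto 0
      rw [add_zero] at this
      exact this.mono_left nhdsWithin_le_nhds
    have hminus : Tendsto (fun η : ℝ => w - η) (𝓝[>] 0) (𝓝 w) := by
      have := (by fun_prop : Continuous fun η : ℝ => w - η).tendsto 0
      rw [sub_zero] at this
      exact this.mono_left nhdsWithin_le_nhds
    refine tendsto_order.2 ⟨fun L hL => ?_, fun L hL => ?_⟩
    · obtain ⟨η, hη, hη0⟩ := (((hcont.comp hplus).eventually_const_lt hL).and
        self_mem_nhdsWithin).exists
      exact h.eventually_gt hαβ hα hN hv
        ((hD.eventually_tail_bounds hη0).mono fun z hz => hz.2) r hη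
    · obtain ⟨η, hη, hη0⟩ := (((hcont.comp hminus).eventually_lt_const hL).and
        self_mem_nhdsWithin).exists
      exact h.eventually_lt hαβ hα hN hv
        ((hD.eventually_tail_bounds hη0).mono fun z hz => hz.1) r hη
  · have h := key hD.uniformlyContinuous
    have hbdd : IsBoundedUnder (· ≤ ·) atTop (fun n =>
        μ.real {x | Homogeneous.windowMax a m D (hαβ n) x ≤ Homogeneous.level v (α n) (β n) r}) :=
      isBoundedUnder_of ⟨1, fun n => measureReal_le_one⟩
    have hbdd' : IsBoundedUnder (· ≥ ·) atTop (fun n =>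
        μ.real {x | Homogeneous.windowMax a m D (hαβ n) x ≤ Homogeneous.level v (α n) (β n) r}) :=
      isBoundedUnder_of ⟨0, fun n => measureReal_nonneg⟩
    refine ⟨le_of_forall_lt_imp_le_of_dense fun L hL => ?_, liminf_le_limsup hbdd hbdd',
      le_of_forall_gt_imp_ge_of_dense fun L hL => ?_⟩
    · exact le_liminf_of_le hbdd.isCoboundedUnder_ge ((h.eventually_gt hαβ hα hN hv
        (hD.tail_bounds.mono fun z hz => hz.2) r hL).mono fun n hn => hn.le)
    · exact limsup_le_of_le hbdd'.isCoboundedUnder_le ((h.eventually_lt hαβ hα hN hv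
        (hD.tail_bounds.mono fun z hz => hz.1) r hL).mono fun n hn => hn.le)
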